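/- Let $d\ge 1$, $\Theta=[\theta_{\inf},\theta_{\sup}]^p\subset\mathbb{R}^p$, and let $\{K_\theta:\theta\in\Theta\}$ be a family of stationary covariance functions on $\mathbb{R}^d$ (that is, $(s,t)\mapsto K_\theta(s-t)$ is symmetric and positive semidefinite) such that: (i) all partial derivatives of $K_\theta(t)$ with respect to $\theta$ up to order three exist on $\Theta$ (one-sided on the boundary), and for all $0\le q\le 3$ and $i_1,\dots,i_q\in\{1,\dots,p\}$ there is $C_{i_1,\dots,i_q}<\infty$ with $$\left|\frac{\partial}{\partial\theta_{i_1}}\cdots\frac{\partial}{\partial\theta_{i_q}}K_\theta(t)\right|\le \frac{C_{i_1,\dots,i_q}}{1+|t|^{d+1}}\qquad\text{for all }\theta\in\Theta,\ t\in\mathbb{R}^d,$$ where $|t|$ is the Euclidean norm; (ii) for every $\theta\in\Theta$, $K_\theta$ and $\hat K_\theta(f)=(2\pi)^{-d}\int_{\mathbb{R}^d}K_\theta(t)e^{-\mathrm{i}f\cdot t}\,dt$ are integrable and $K_\theta(t)=\int_{\mathbb{R}^d}\hat K_\theta(f)e^{\mathrm{i}f\cdot t}\,df$ for all $t\in\mathbb{R}^d$;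 (iii) $(f,\theta)\mapsto\hat K_\theta(f)$ is real-valued, continuous and positive on $\mathbb{R}^d\times\Theta$. Let $\theta_0$ satisfy $\theta_{\inf}<(\theta_0)_i<\theta_{\sup}$ for $1\le i\le p$, and let $Y$ be a centered Gaussian process on $\mathbb{R}^d$ with covariance function $K_{\theta_0}$, defined on a probability space $(\Omega_Y,P_Y)$. Let $(v_i)_{i\ge1}$ be a deterministic sequence in $\{1,2,\dots\}^d$ with $\{v_i:1\le i\le N^d\}=\{1,\dots,N\}^d$ for all $N\ge1$, and let $\epsilon\in[0,\tfrac12)$. Let $\mathcal{L}_X$ be a symmetric probability distribution on $\mathbb{R}^d$ with (closed) support $S_X\subset[-1,1]^d$ and with a Lebesgue density that is positive on $S_X$, and let $(X_i)_{i\ge1}$ be i.i.d. with law $\mathcal{L}_X$ on a probability space $(\Omega_X,P_X)$. On the product space $(\Omega_X\times\Omega_Y,P_X\times P_Y)$, let $y=(Y(v_i+\epsilon X_i))_{1\le i\le n}$, assumed to be a random vector for every $n$, and let $R_\theta$ be the $n\times n$ matrix with entries $K_\theta(v_i-v_j+\epsilon(X_i-X_j))$. Let $$L_\theta=\frac1n\left\{\log\det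 R_\theta+y^{t}R_\theta^{-1}y\right\}$$ and let $\hat\theta_{ML}=\hat\theta_{ML}(n)$ be any choice of a global minimizer of $\theta\mapsto L_\theta$ over $\Theta$ (almost surely, for each $n\ge1$). Say that the ML estimator is consistent if every such $\hat\theta_{ML}$ converges to $\theta_0$ in $P_X\times P_Y$-probability as $n\to\infty$. (a) For $\epsilon=0$: if there does not exist $\theta\in\Theta$, $\theta\ne\theta_0$, such that $K_\theta(v)=K_{\theta_0}(v)$ for all $v\in\mathbb{Z}^d$, then the ML estimator is consistent. (b) For $\epsilon\neq0$: let $C_{S_X}=\{t_1-t_2:\ t_1,t_2\in S_X\}$ and $D_\epsilon=\bigcup_{v\in\mathbb{Z}^d\setminus\{0\}}(v+\epsilon C_{S_X})$. If there does not exist $\theta\in\Theta$, $\theta\neq\theta_0$, such that $K_\theta=K_{\theta_0}$ Lebesgue-almost everywhere on $D_\epsilon$ and $K_\theta(0)=K_{\theta_0}(0)$, then the ML estimator is consistent. -/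

import Mathlib

open MeasureTheory ProbabilityTheory Filter Topology
open scoped Pointwise

namespace PerturbedGrid

noncomputable section

/-- The parameter set `Θ = [a, b]^p`. -/
def paramSet (p : ℕ) (a b : ℝ) : Set (Fin p → ℝ) := Set.Icc (fun _ => a) (fun _ => b)

/-- The partial derivative of `g` with respect to the `i`-th parameter, on the cube `[a, b]^p`
(one-sided on the faces of the cube). -/
def paramPartial {p : ℕ} (a b : ℝ) (i : Fin p) (g : (Fin p → ℝ) → ℝ) (θ : Fin p → ℝ) : ℝ :=
  derivWithin (fun s => g (Function.update θ i s)) (Set.Icc a b) (θ i)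

/-- Iterated partial derivatives: for `I = [i₁, …, i_q]` this is `∂/∂θ_{i₁} ⋯ ∂/∂θ_{i_q} g`. -/
def iterParamPartial {p : ℕ} (a b : ℝ) :
    List (Fin p) → ((Fin p → ℝ) → ℝ) → (Fin p → ℝ) → ℝ
  | [], g => g
  | i :: I, g => paramPartial a b i (iterParamPartial a b I g)

/-- `k` is a stationary covariance function on `ℝ^d`: the kernel `(s, t) ↦ k (s - t)` is symmetric
and positive semidefinite. -/
def IsStationaryCovariance {d : ℕ} (k : EuclideanSpace ℝ (Fin d) → ℝ) : Prop :=
  ∀ (n : ℕ) (x : Fin n → EuclideanSpace ℝ (Fin d)),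
    (Matrix.of fun i j => k (x i - x j)).PosSemidef

/-- The Fourier transform `ĥ(f) = (2π)^{-d} ∫ h(t) e^{-i f·t} dt`. -/
def fourierTransform {d : ℕ} (h : EuclideanSpace ℝ (Fin d) → ℝ)
    (f : EuclideanSpace ℝ (Fin d)) : ℂ :=
  (((2 * Real.pi) ^ d)⁻¹ : ℝ) *
    ∫ t, (h t : ℂ) * Complex.exp (-(Complex.I * (inner ℝ f t : ℝ)))

/-- The regularity condition on the parametric model `{K_θ, θ ∈ Θ}`, `Θ = [a, b]^p`, of
stationary covariance functions on `ℝ^d`. -/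
structure RegularModel {d p : ℕ} (a b : ℝ)
    (K : (Fin p → ℝ) → EuclideanSpace ℝ (Fin d) → ℝ) : Prop where
  stationary : ∀ θ ∈ paramSet p a b, IsStationaryCovariance (K θ)
  /-- All partial derivatives in `θ` up to order three exist on `Θ`. -/
  differentiable : ∀ I : List (Fin p), I.length < 3 → ∀ i : Fin p, ∀ θ ∈ paramSet p a b,
    ∀ t : EuclideanSpace ℝ (Fin d), DifferentiableWithinAt ℝ
      (fun s => iterParamPartial a b I (fun θ' => K θ' t) (Function.update θ i s))
      (Set.Icc a b) (θ i)
  /-- They decay at rate `|t|^{-(d+1)}`, uniformly in `θ`. -/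
  bound : ∀ I : List (Fin p), I.length ≤ 3 → ∃ C : ℝ, ∀ θ ∈ paramSet p a b,
    ∀ t : EuclideanSpace ℝ (Fin d),
      |iterParamPartial a b I (fun θ' => K θ' t) θ| ≤ C / (1 + ‖t‖ ^ (d + 1))
  /-- The integrals defining the Fourier transform and its inverse converge absolutely. -/
  integrable : ∀ θ ∈ paramSet p a b, Integrable (K θ)
  integrable_fourier : ∀ θ ∈ paramSet p a b, Integrable (fourierTransform (K θ))
  /-- Fourier inversion holds pointwise. -/
  inversion : ∀ θ ∈ paramSet p a b, ∀ t : EuclideanSpace ℝ (Fin d),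
    (K θ t : ℂ) =
      ∫ f, fourierTransform (K θ) f * Complex.exp (Complex.I * (inner ℝ f t : ℝ))
  /-- `(f, θ) ↦ K̂_θ(f)` is jointly continuous. -/
  fourier_continuous : ContinuousOn
    (fun q : EuclideanSpace ℝ (Fin d) × (Fin p → ℝ) => fourierTransform (K q.2) q.1)
    (Set.univ ×ˢ paramSet p a b)
  /-- `K̂_θ` is real and positive. -/
  fourier_pos : ∀ θ ∈ paramSet p a b, ∀ f : EuclideanSpace ℝ (Fin d),
    0 < (fourierTransform (K θ) f).re ∧ (fourierTransform (K θ) f).im = 0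

/-- The point of `ℝ^d` with the given integer coordinates. -/
def latticePoint {d : ℕ} (u : Fin d → ℤ) : EuclideanSpace ℝ (Fin d) :=
  WithLp.toLp 2 fun k => (u k : ℝ)

/-- `v` enumerates `(ℕ*)^d` along growing cubes: for every `N ≥ 1` its first `N ^ d` terms (indexed
by `0, …, N ^ d - 1`) are exactly the points of `{1, …, N}^d`. -/
def IsGridSequence {d : ℕ} (v : ℕ → Fin d → ℤ) : Prop :=
  ∀ N : ℕ, 1 ≤ N → v '' Set.Iio (N ^ d) = {u | ∀ k, 1 ≤ u k ∧ u k ≤ (N : ℤ)}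

/-- `L` is a symmetric probability distribution whose (closed topological) support `S_X` lies in
`[-1, 1]^d`, with a Lebesgue density that is positive on `S_X`. -/
structure IsPerturbationLaw {d : ℕ} (L : Measure (EuclideanSpace ℝ (Fin d))) : Prop where
  prob : IsProbabilityMeasure L
  symm : L.map (fun t => -t) = L
  support_subset : L.support ⊆ {t | ∀ k, -1 ≤ t k ∧ t k ≤ 1}
  density : ∃ f : EuclideanSpace ℝ (Fin d) → ENNReal, Measurable f ∧
    L = volume.withDensity f ∧ ∀ t ∈ L.support, 0 < f t

/-- The observation points `v_i + ε x_i`. -/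
def obsPoint {d : ℕ} (v : ℕ → Fin d → ℤ) (ε : ℝ) (x : ℕ → EuclideanSpace ℝ (Fin d)) (i : ℕ) :
    EuclideanSpace ℝ (Fin d) :=
  latticePoint (v i) + ε • x i

/-- The `n × n` matrix `R_θ = (k(v_i - v_j + ε (x_i - x_j)))_{i,j}`, for `k = K_θ`. -/
def covMatrix {d : ℕ} (k : EuclideanSpace ℝ (Fin d) → ℝ) (v : ℕ → Fin d → ℤ) (ε : ℝ)
    (x : ℕ → EuclideanSpace ℝ (Fin d)) (n : ℕ) : Matrix (Fin n) (Fin n) ℝ :=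
  Matrix.of fun i j => k (obsPoint v ε x i - obsPoint v ε x j)

/-- The modified opposite log-likelihood `(1/n) (log det R + yᵗ R⁻¹ y)`. -/
def negLogLik {n : ℕ} (R : Matrix (Fin n) (Fin n) ℝ) (y : Fin n → ℝ) : ℝ :=
  (1 / (n : ℝ)) * (Real.log R.det + y ⬝ᵥ (R⁻¹.mulVec y))

/-- The observation vector `y = (Y(v_i + ε X_i))_{i < n}` on the product space. -/
def obs {d : ℕ} {ΩX ΩY : Type*} (v : ℕ → Fin d → ℤ) (ε : ℝ)
    (X : ℕ → ΩX → EuclideanSpace ℝ (Fin d)) (Y : EuclideanSpace ℝ (Fin d) → ΩY → ℝ)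
    (n : ℕ) (ω : ΩX × ΩY) : Fin n → ℝ :=
  fun i => Y (obsPoint v ε (fun j => X j ω.1) i) ω.2

/-- `T` is a maximum likelihood estimator: for every sample size `n ≥ 1`, almost surely, `T n` is a
global minimizer over `Θ` of the modified opposite log-likelihood of the first `n` observations. -/
def IsMLEstimator {d p : ℕ} {ΩX ΩY : Type*} [MeasurableSpace ΩX] [MeasurableSpace ΩY]
    (P : Measure (ΩX × ΩY)) (a b : ℝ) (K : (Fin p → ℝ) → EuclideanSpace ℝ (Fin d) → ℝ)
    (v : ℕ → Fin d → ℤ) (ε : ℝ) (X : ℕ → ΩX → EuclideanSpace ℝ (Fin d))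
    (Y : EuclideanSpace ℝ (Fin d) → ΩY → ℝ) (T : ℕ → ΩX × ΩY → Fin p → ℝ) : Prop :=
  ∀ n : ℕ, 1 ≤ n → ∀ᵐ ω ∂P, T n ω ∈ paramSet p a b ∧
    ∀ θ ∈ paramSet p a b,
      negLogLik (covMatrix (K (T n ω)) v ε (fun j => X j ω.1) n) (obs v ε X Y n ω) ≤
        negLogLik (covMatrix (K θ) v ε (fun j => X j ω.1) n) (obs v ε X Y n ω)

/-- `D_ε = ⋃_{v ∈ ℤ^d, v ≠ 0} (v + ε C_S)`, with `C_S = S - S` the set of differences of two points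
of `S`. -/
def diffSet {d : ℕ} (S : Set (EuclideanSpace ℝ (Fin d))) (ε : ℝ) :
    Set (EuclideanSpace ℝ (Fin d)) :=
  ⋃ u ∈ {u : Fin d → ℤ | u ≠ 0}, (latticePoint u +ᵥ ε • (S - S))

end

end PerturbedGrid

/-! Fix `θ` and let `μ i` be the eigenvalues of `R_θ` relative to `R_{θ₀}`. In coordinates `w` that
whiten the observations, `L_θ - L_{θ₀}` is the mean of `log μ + (μ⁻¹ - 1) w²` with independent
standard Gaussian `w`. Given the perturbations, each term has expectation `ν - 1 - log ν` with `ν =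
μ⁻¹`, which dominates a multiple of `(ν - 1)²` when `ν` is bounded. The sum of the `(ν - 1)²` is in
turn bounded below by a multiple of the squared Frobenius distance between `R_θ` and `R_{θ₀}`. If
that distance is of order `n`, Chebyshev gives a fixed gap with probability tending to one
(`exists_measure_negLogLik_le`).

The distance is of order `n` as soon as `K_θ` and `K_{θ₀}` differ at `0` or at one point `u + ε(s₁ -
s₂)` with `u ≠ 0` and `s₁, s₂` in the support: a positive proportion of pairs of sites differ by
`u`, and a positive fraction of these have perturbations near `s₁` and `s₂`
(`exists_tendsto_measure_sum_sq_lt`).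

All this needs eigenvalue bounds uniform in `n`, `θ` and the perturbations. They come from the
separation of the points, which holds because `ε < 1/2`: the upper bound is a lattice sum, the lower
bound compares the spectral density with a rescaled bump (`exists_form_lower_bound`). The same
bounds make the criterion Lipschitz in `θ` once the mean square of the observations is bounded, so a
finite cover of `{‖θ - θ₀‖ ≥ α}` turns the gaps at fixed parameters into consistency
(`tendstoInMeasure_of_distinguishable`). Both identifiability conditions reduce to this theorem. -/

namespace PerturbedGrid

/-! ### Linear algebra of the likelihood criterion -/

section LinearAlgebra

open Matrix

variable {n : ℕ}

lemma exists_orthogonal_diagonalization {M : Matrix (Fin n) (Fin n) ℝ} (hM : M.PosDef) :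
    ∃ (U : Matrix (Fin n) (Fin n) ℝ) (μ : Fin n → ℝ), (∀ i, 0 < μ i) ∧ U * Uᵀ = 1 ∧
      M = U * diagonal μ * Uᵀ := by
  refine ⟨hM.1.eigenvectorUnitary, hM.1.eigenvalues, hM.eigenvalues_pos, ?_, ?_⟩
  · have := Unitary.coe_mul_star_self hM.1.eigenvectorUnitary
    rwa [Unitary.coe_star, star_eq_conjTranspose, conjTranspose_eq_transpose_of_trivial] at this
  · have := hM.1.spectral_theorem
    rw [Unitary.conjStarAlgAut_apply, star_eq_conjTranspose,
      conjTranspose_eq_transpose_of_trivial] at this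
    exact this

/-- Two positive definite matrices are diagonalized by the same congruence. -/
lemma exists_simultaneous_diagonalization {R₀ R : Matrix (Fin n) (Fin n) ℝ}
    (h₀ : R₀.PosDef) (h : R.PosDef) :
    ∃ (A B : Matrix (Fin n) (Fin n) ℝ) (μ : Fin n → ℝ), (∀ i, 0 < μ i) ∧ A * B = 1 ∧ B * A = 1 ∧
      R₀ = A * Aᵀ ∧ R = A * diagonal μ * Aᵀ := by
  obtain ⟨U, l, hl, hU, hR₀⟩ := exists_orthogonal_diagonalization h₀
  have hU' : Uᵀ * U = 1 := mul_eq_one_comm.1 hU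
  -- `C` is a square root of `R₀` in the sense `R₀ = C Cᵀ`, and `D` is its inverse. Diagonalizing
  -- the whitened matrix `D R Dᵀ` by an orthogonal `V` gives `A = C V`, since `V` does not disturb
  -- `C Cᵀ`.
  set C := U * diagonal (fun i => √(l i)) with hC
  set D := diagonal (fun i => (√(l i))⁻¹) * Uᵀ with hD
  have hl' : ∀ i, √(l i) ≠ 0 := fun i => (Real.sqrt_pos.2 (hl i)).ne'
  have hDC : D * C = 1 := by
    rw [hC, hD, Matrix.mul_assoc, ← Matrix.mul_assoc Uᵀ, hU', Matrix.one_mul, diagonal_mul_diagonal]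
    simp [hl']
  have hCD : C * D = 1 := mul_eq_one_comm.1 hDC
  have hCC : R₀ = C * Cᵀ := by
    rw [hC, transpose_mul, diagonal_transpose, Matrix.mul_assoc, ← Matrix.mul_assoc (diagonal _),
      diagonal_mul_diagonal, ← Matrix.mul_assoc, hR₀]
    simp [Real.mul_self_sqrt (hl _).le]
  have hM : (D * R * Dᵀ).PosDef := by
    have := h.mul_mul_conjTranspose_same (B := D) (by
      intro x y hxy
      have := congrArg (fun z => z ᵥ* C) hxy
      simpa [vecMul_vecMul, hDC] using this)
    rwa [conjTranspose_eq_transpose_of_trivial] at this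
  obtain ⟨V, μ, hμ, hV, hVM⟩ := exists_orthogonal_diagonalization hM
  have hV' : Vᵀ * V = 1 := mul_eq_one_comm.1 hV
  have h1 : C * V * (Vᵀ * D) = 1 := by
    rw [Matrix.mul_assoc, ← Matrix.mul_assoc V, hV, Matrix.one_mul, hCD]
  refine ⟨C * V, Vᵀ * D, μ, hμ, h1, mul_eq_one_comm.1 h1, ?_, ?_⟩
  · rw [transpose_mul, Matrix.mul_assoc, ← Matrix.mul_assoc V, hV, Matrix.one_mul, hCC]
  · have hDCt : Dᵀ * Cᵀ = 1 := by rw [← transpose_mul, hCD, transpose_one]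
    calc R = C * D * R * (Dᵀ * Cᵀ) := by rw [hCD, hDCt, Matrix.one_mul, Matrix.mul_one]
      _ = C * (D * R * Dᵀ) * Cᵀ := by simp only [Matrix.mul_assoc]
      _ = _ := by rw [hVM]; simp only [Matrix.mul_assoc, transpose_mul]

lemma posDef_of_form_lower_bound {R : Matrix (Fin n) (Fin n) ℝ} (hs : Rᵀ = R) {c : ℝ} (hc : 0 < c)
    (h : ∀ x, c * (x ⬝ᵥ x) ≤ x ⬝ᵥ R *ᵥ x) : R.PosDef := by
  refine PosDef.of_dotProduct_mulVec_pos ?_ fun x hx => ?_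
  · rwa [IsHermitian, conjTranspose_eq_transpose_of_trivial]
  · have : 0 < x ⬝ᵥ x := by simpa using dotProduct_star_self_pos_iff.2 hx
    rw [star_trivial]
    exact (mul_pos hc this).trans_le (h x)

variable {A B : Matrix (Fin n) (Fin n) ℝ} {μ : Fin n → ℝ} {R₀ R : Matrix (Fin n) (Fin n) ℝ}

lemma dotProduct_self_nonneg_real (x : Fin n → ℝ) : 0 ≤ x ⬝ᵥ x :=
  Finset.sum_nonneg fun i _ => mul_self_nonneg (x i)

lemma inv_of_congruence_diagonal (hμ : ∀ i, 0 < μ i) (hAB : A * B = 1)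
    (hR : R = A * diagonal μ * Aᵀ) : R⁻¹ = Bᵀ * diagonal (fun i => (μ i)⁻¹) * B := by
  have hBA : B * A = 1 := mul_eq_one_comm.1 hAB
  have hBAt : Aᵀ * Bᵀ = 1 := by rw [← transpose_mul, hBA, transpose_one]
  have hd : diagonal μ * diagonal (fun i => (μ i)⁻¹) = 1 := by
    rw [diagonal_mul_diagonal]; simp [(hμ _).ne']
  refine inv_eq_right_inv ?_
  calc R * (Bᵀ * diagonal (fun i => (μ i)⁻¹) * B)
      = A * (diagonal μ * ((Aᵀ * Bᵀ) * diagonal (fun i => (μ i)⁻¹))) * B := by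
        rw [hR]; simp only [Matrix.mul_assoc]
    _ = 1 := by rw [hBAt, Matrix.one_mul, hd, Matrix.mul_one, hAB]

lemma dotProduct_congruence_diagonal (C : Matrix (Fin n) (Fin n) ℝ) (μ y : Fin n → ℝ) :
    y ⬝ᵥ (Cᵀ * diagonal μ * C) *ᵥ y = ∑ i, μ i * (C *ᵥ y) i ^ 2 := by
  rw [← mulVec_mulVec, ← mulVec_mulVec, dotProduct_mulVec, vecMul_transpose]
  simp only [dotProduct, mulVec_diagonal]
  exact Finset.sum_congr rfl fun i _ => by ring

lemma log_det_congruence_diagonal (hμ : ∀ i, 0 < μ i) (hAB : A * B = 1) (hR₀ : R₀ = A * Aᵀ)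
    (hR : R = A * diagonal μ * Aᵀ) :
    Real.log R.det = Real.log R₀.det + ∑ i, Real.log (μ i) := by
  have hA : A.det ≠ 0 := by
    intro h
    have := congrArg det hAB
    simp [h] at this
  rw [hR, hR₀, det_mul, det_mul, det_mul, det_diagonal, det_transpose,
    ← Real.log_prod (fun i _ => (hμ i).ne'), ← Real.log_mul (mul_ne_zero hA hA)
      (Finset.prod_ne_zero_iff.2 fun i _ => (hμ i).ne')]
  ring_nf

/-- Both quadratic forms become diagonal in the coordinates `B y`, where `R₀` is the identity, and
the determinant of `A` cancels. -/
lemma negLogLik_sub_eq (hμ : ∀ i, 0 < μ i) (hAB : A * B = 1) (hR₀ : R₀ = A * Aᵀ)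
    (hR : R = A * diagonal μ * Aᵀ) (y : Fin n → ℝ) :
    negLogLik R y - negLogLik R₀ y =
      (1 / (n : ℝ)) * ∑ i, (Real.log (μ i) + ((μ i)⁻¹ - 1) * (B *ᵥ y) i ^ 2) := by
  have hR₀' : R₀ = A * diagonal (fun _ => (1 : ℝ)) * Aᵀ := by
    rw [hR₀, diagonal_one, Matrix.mul_one]
  unfold negLogLik
  rw [log_det_congruence_diagonal hμ hAB hR₀ hR, inv_of_congruence_diagonal hμ hAB hR,
    inv_of_congruence_diagonal (fun _ => one_pos) hAB hR₀', dotProduct_congruence_diagonal,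
    dotProduct_congruence_diagonal, ← mul_sub, Finset.sum_add_distrib]
  simp only [inv_one, one_mul, sub_mul, Finset.sum_sub_distrib]
  ring

/-- The `i`-th column of `Bᵀ` is the relative eigenvector for `μ i`. This converts bounds on
quadratic forms into bounds on `μ i`. -/
lemma exists_rayleigh_vector (hBA : B * A = 1) (hR₀ : R₀ = A * Aᵀ)
    (hR : R = A * diagonal μ * Aᵀ) (i : Fin n) :
    ∃ x, x ⬝ᵥ R₀ *ᵥ x = 1 ∧ x ⬝ᵥ R *ᵥ x = μ i := by
  have hx : Aᵀ *ᵥ (Bᵀ *ᵥ Pi.single i 1) = Pi.single i 1 := by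
    rw [mulVec_mulVec, ← transpose_mul, hBA, transpose_one, one_mulVec]
  have key : ∀ ν : Fin n → ℝ, (Bᵀ *ᵥ Pi.single i 1) ⬝ᵥ
      (A * diagonal ν * Aᵀ) *ᵥ (Bᵀ *ᵥ Pi.single i 1) = ν i := by
    intro ν
    have := dotProduct_congruence_diagonal Aᵀ ν (Bᵀ *ᵥ Pi.single i 1)
    rw [transpose_transpose] at this
    rw [this, hx, Finset.sum_eq_single i]
    · simp
    · intro j _ hj; simp [hj]
    · simp
  refine ⟨Bᵀ *ᵥ Pi.single i 1, ?_, by rw [hR, key]⟩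
  have := key (fun _ => 1)
  rwa [diagonal_one, Matrix.mul_one, ← hR₀] at this

/-- Lipschitz estimate for the likelihood as a function of the covariance matrix. -/
lemma negLogLik_sub_le (hn : 0 < n) {R' R : Matrix (Fin n) (Fin n) ℝ} (hs : Rᵀ = R)
    (hs' : R'ᵀ = R') {c κ : ℝ} (hc : 0 < c) (hκ : 0 ≤ κ)
    (h : ∀ x, c * (x ⬝ᵥ x) ≤ x ⬝ᵥ R *ᵥ x) (h' : ∀ x, c * (x ⬝ᵥ x) ≤ x ⬝ᵥ R' *ᵥ x)
    (hd : ∀ x, |x ⬝ᵥ R *ᵥ x - x ⬝ᵥ R' *ᵥ x| ≤ κ * (x ⬝ᵥ x)) (y : Fin n → ℝ) :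
    negLogLik R' y - negLogLik R y ≤ κ / c + κ / c ^ 2 * ((1 / (n : ℝ)) * (y ⬝ᵥ y)) := by
  obtain ⟨A, B, μ, hμ, hAB, hBA, hR, hR'⟩ := exists_simultaneous_diagonalization
    (posDef_of_form_lower_bound hs hc h) (posDef_of_form_lower_bound hs' hc h')
  -- The difference of the forms at the eigenvector is `1 - μ i`, and `x ⬝ᵥ x` is at most both `1 /
  -- c` and `μ i / c`. The first bound controls `μ i`, the second its inverse.
  have hμ1 : ∀ i, μ i ≤ 1 + κ / c ∧ (μ i)⁻¹ ≤ 1 + κ / c := by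
    intro i
    obtain ⟨x, hx, hx'⟩ := exists_rayleigh_vector hBA hR hR' i
    have e1 := abs_le.1 (hd x)
    have e2 := h x
    have e3 := h' x
    rw [hx, hx'] at e1
    rw [hx] at e2
    rw [hx'] at e3
    have hxx : x ⬝ᵥ x ≤ 1 / c := by rw [le_div_iff₀ hc]; linarith
    have hxx' : x ⬝ᵥ x ≤ μ i / c := by rw [le_div_iff₀ hc]; linarith
    have e4 : κ * (x ⬝ᵥ x) ≤ κ * (1 / c) := by gcongr
    have e5 : κ * (x ⬝ᵥ x) ≤ κ * (μ i / c) := by gcongr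
    constructor
    · have : κ / c = κ * (1 / c) := by ring
      linarith
    · rw [inv_le_iff_one_le_mul₀ (hμ i)]
      have : (1 + κ / c) * μ i = μ i + κ * (μ i / c) := by ring
      linarith
  have hBy : ∑ i, (B *ᵥ y) i ^ 2 ≤ (1 / c) * (y ⬝ᵥ y) := by
    have hxy : y = A *ᵥ (B *ᵥ y) := by rw [mulVec_mulVec, hAB, one_mulVec]
    have key : (B *ᵥ y) ⬝ᵥ (B *ᵥ y) ≤ (1 / c) * (y ⬝ᵥ y) := by
      set z := B *ᵥ y with hz
      set u := Bᵀ *ᵥ z with hu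
      have h1 : u ⬝ᵥ R *ᵥ u = z ⬝ᵥ z := by
        have hAu : Aᵀ *ᵥ u = z := by
          rw [hu, mulVec_mulVec, ← transpose_mul, hBA, transpose_one, one_mulVec]
        rw [hR, ← mulVec_mulVec, hAu, dotProduct_mulVec, ← mulVec_transpose, hAu]
      have h2 : u ⬝ᵥ y = z ⬝ᵥ z := by
        rw [hu, mulVec_transpose, ← dotProduct_mulVec]
      have h3 := h u
      rw [h1] at h3
      -- Here `u = R⁻¹ y`. Expanding this square and using `c |u|² ≤ u ⬝ᵥ R u = u ⬝ᵥ y` gives `yᵀ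
      -- R⁻¹ y ≤ |y|² / c`.
      have h4 : 0 ≤ (u - (1 / c) • y) ⬝ᵥ (u - (1 / c) • y) := dotProduct_self_nonneg_real _
      rw [sub_dotProduct, dotProduct_sub, dotProduct_sub, smul_dotProduct, smul_dotProduct,
        dotProduct_smul, dotProduct_smul, dotProduct_comm y u, h2] at h4
      simp only [smul_eq_mul] at h4
      have h5 : c * ((u ⬝ᵥ u - 1 / c * (z ⬝ᵥ z)) - (1 / c * (z ⬝ᵥ z) - 1 / c * (1 / c * (y ⬝ᵥ y)))) =
          c * (u ⬝ᵥ u) - 2 * (z ⬝ᵥ z) + 1 / c * (y ⬝ᵥ y) := by field_simp; ring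
      have h6 := mul_nonneg hc.le h4
      linarith
    simpa [dotProduct, sq] using key
  rw [negLogLik_sub_eq hμ hAB hR hR']
  have hκc : 0 ≤ κ / c := by positivity
  have hsum : ∑ i, (Real.log (μ i) + ((μ i)⁻¹ - 1) * (B *ᵥ y) i ^ 2) ≤
      n * (κ / c) + κ / c * ((1 / c) * (y ⬝ᵥ y)) := by
    calc _ ≤ ∑ i, (κ / c + κ / c * (B *ᵥ y) i ^ 2) := by
          refine Finset.sum_le_sum fun i _ => add_le_add ?_ ?_
          · linarith [Real.log_le_sub_one_of_pos (hμ i), (hμ1 i).1]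
          · exact mul_le_mul_of_nonneg_right (by linarith [(hμ1 i).2]) (sq_nonneg _)
      _ = n * (κ / c) + κ / c * ∑ i, (B *ᵥ y) i ^ 2 := by
          rw [Finset.sum_add_distrib, ← Finset.mul_sum]; simp
      _ ≤ _ := by gcongr
  have hn' : (0 : ℝ) < n := by exact_mod_cast hn
  calc _ ≤ (1 / (n : ℝ)) * (n * (κ / c) + κ / c * ((1 / c) * (y ⬝ᵥ y))) := by gcongr
    _ = _ := by field_simp

/-- `A` and `Aᵀ` have the same operator norm: with `z = A x`, Cauchy–Schwarz gives `|z|⁴ = ⟨Aᵀ z,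
x⟩² ≤ C |z|² |x|²`. -/
lemma dotProduct_mulVec_transpose_le {A : Matrix (Fin n) (Fin n) ℝ} {C : ℝ} (hC : 0 ≤ C)
    (h : ∀ x, x ⬝ᵥ (A * Aᵀ) *ᵥ x ≤ C * (x ⬝ᵥ x)) (x : Fin n → ℝ) :
    (A *ᵥ x) ⬝ᵥ (A *ᵥ x) ≤ C * (x ⬝ᵥ x) := by
  set z := A *ᵥ x with hz
  have h1 : (Aᵀ *ᵥ z) ⬝ᵥ (Aᵀ *ᵥ z) ≤ C * (z ⬝ᵥ z) := by
    have := h z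
    rwa [← mulVec_mulVec, dotProduct_mulVec, ← mulVec_transpose] at this
  have h2 : (Aᵀ *ᵥ z) ⬝ᵥ x = z ⬝ᵥ z := by
    rw [mulVec_transpose, ← dotProduct_mulVec]
  have h3 : ((Aᵀ *ᵥ z) ⬝ᵥ x) ^ 2 ≤ ((Aᵀ *ᵥ z) ⬝ᵥ (Aᵀ *ᵥ z)) * (x ⬝ᵥ x) := by
    simpa [dotProduct, sq] using Finset.sum_mul_sq_le_sq_mul_sq Finset.univ (Aᵀ *ᵥ z) x
  rw [h2] at h3
  have hx := dotProduct_self_nonneg_real x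
  have hz0 := dotProduct_self_nonneg_real z
  rcases hz0.eq_or_lt with h0 | h0
  · rw [← h0]; positivity
  · have : (z ⬝ᵥ z) ^ 2 ≤ C * (z ⬝ᵥ z) * (x ⬝ᵥ x) := h3.trans (by gcongr)
    nlinarith

/-- The Frobenius norm of a congruence transform. -/
lemma sum_sq_congruence_le {A : Matrix (Fin n) (Fin n) ℝ} {C : ℝ} (hC : 0 ≤ C)
    (h : ∀ x, x ⬝ᵥ (A * Aᵀ) *ᵥ x ≤ C * (x ⬝ᵥ x)) (D : Matrix (Fin n) (Fin n) ℝ) :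
    ∑ i, ∑ j, (A * D * Aᵀ) i j ^ 2 ≤ C ^ 2 * ∑ i, ∑ j, D i j ^ 2 := by
  -- Left multiplication by `A` acts on each column. Right multiplication by `Aᵀ` is the same
  -- operation after a transposition.
  have key : ∀ M : Matrix (Fin n) (Fin n) ℝ,
      ∑ i, ∑ j, (A * M) i j ^ 2 ≤ C * ∑ i, ∑ j, M i j ^ 2 := by
    intro M
    rw [Finset.sum_comm, Finset.sum_comm (f := fun i j => M i j ^ 2), Finset.mul_sum]
    refine Finset.sum_le_sum fun j _ => ?_
    have := dotProduct_mulVec_transpose_le hC h (fun i => M i j)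
    simpa [dotProduct, sq, mulVec, Matrix.mul_apply] using this
  calc ∑ i, ∑ j, (A * D * Aᵀ) i j ^ 2 = ∑ i, ∑ j, (A * (A * D)ᵀ) i j ^ 2 := by
        rw [Finset.sum_comm]
        refine Finset.sum_congr rfl fun i _ => Finset.sum_congr rfl fun j _ => ?_
        rw [← Matrix.transpose_apply (A * D * Aᵀ), Matrix.transpose_mul, Matrix.transpose_transpose]
    _ ≤ C * ∑ i, ∑ j, (A * D)ᵀ i j ^ 2 := key _
    _ = C * ∑ i, ∑ j, (A * D) i j ^ 2 := by rw [Finset.sum_comm]; rfl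
    _ ≤ C * (C * ∑ i, ∑ j, D i j ^ 2) := by gcongr; exact key D
    _ = _ := by ring

end LinearAlgebra

/-! ### Concentration of the Gaussian likelihood ratio -/

section Gaussian

open Matrix

variable {Ω : Type*} [MeasurableSpace Ω] {P : Measure Ω}

lemma memLp_two_sq_of_hasGaussianLaw {w : Ω → ℝ} (hw : HasGaussianLaw w P) :
    MemLp (fun ω => w ω ^ 2) 2 P := by
  have h4 : MemLp w 4 P := hw.memLp (by simp)
  rw [memLp_two_iff_integrable_sq (h4.1.aemeasurable.pow_const 2).aestronglyMeasurable]
  have := h4.integrable_norm_pow (p := 4) (by norm_num)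
  refine this.congr (ae_of_all _ fun ω => ?_)
  simp only [Real.norm_eq_abs]
  rw [← pow_mul, show 2 * 2 = 4 by norm_num, Even.pow_abs (by decide)]

/-- The variance of the square of a standard Gaussian variable. -/
noncomputable def sqGaussianVariance : ℝ := Var[fun x : ℝ => x ^ 2; gaussianReal 0 1]

lemma sqGaussianVariance_nonneg : 0 ≤ sqGaussianVariance := variance_nonneg _ _

lemma variance_sq_of_standard {w : Ω → ℝ} (hw : HasGaussianLaw w P) (h0 : P[w] = 0)
    (h1 : Var[w; P] = 1) : Var[fun ω => w ω ^ 2; P] = sqGaussianVariance := by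
  have hmap := hw.map_eq_gaussianReal
  rw [h0, h1, Real.toNNReal_one] at hmap
  rw [sqGaussianVariance, ← hmap, variance_map (by fun_prop) hw.aemeasurable]
  rfl

/-- From `log ν = 2 log √ν ≤ 2 (√ν - 1)` one gets `ν - 1 - log ν ≥ (√ν - 1)²`, and `(ν - 1)² = (√ν -
1)² (√ν + 1)²`. -/
lemma sq_one_sub_le_sub_log {ν D : ℝ} (hν : 0 < ν) (hD : ν ≤ D) :
    (ν - 1) ^ 2 / (1 + √D) ^ 2 ≤ ν - 1 - Real.log ν := by
  have hs : 0 < √ν := Real.sqrt_pos.2 hν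
  have h1 : Real.log ν ≤ 2 * (√ν - 1) := by
    have := Real.log_le_sub_one_of_pos hs
    rw [Real.log_sqrt hν.le] at this
    linarith
  have h2 : √ν ^ 2 = ν := Real.sq_sqrt hν.le
  have h3 : √ν ≤ √D := Real.sqrt_le_sqrt hD
  rw [div_le_iff₀ (by positivity)]
  calc (ν - 1) ^ 2 = (1 - √ν) ^ 2 * (1 + √ν) ^ 2 := by nth_rw 1 [← h2]; ring
    _ ≤ (1 - √ν) ^ 2 * (1 + √D) ^ 2 := by gcongr
    _ ≤ (ν - 1 - Real.log ν) * (1 + √D) ^ 2 := by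
        gcongr
        nlinarith

variable {n : ℕ}

/-- Chebyshev's inequality for a weighted sum of squares of independent standard Gaussian
variables. -/
lemma measure_sum_sq_le [IsProbabilityMeasure P] {w : Fin n → Ω → ℝ} (hw : HasGaussianLaw (fun ω i => w i ω) P)
    (h0 : ∀ i, P[w i] = 0) (hcov : ∀ i j, cov[w i, w j; P] = if i = j then 1 else 0)
    {ν : Fin n → ℝ} (hν : ∀ i, 0 < ν i) {D : ℝ} (hD : ∀ i, ν i ≤ D) {κ : ℝ} (hκ : 0 < κ)
    (hn : 0 < n) (hS : κ * n ≤ ∑ i, (ν i - 1) ^ 2) :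
    P {ω | ∑ i, (-Real.log (ν i) + (ν i - 1) * w i ω ^ 2) ≤ κ / (1 + √D) ^ 2 / 2 * n} ≤
      ENNReal.ofReal
        (4 * (D + 1) ^ 2 * sqGaussianVariance / (κ / (1 + √D) ^ 2) ^ 2 / n) := by
  have hn' : (0 : ℝ) < n := by exact_mod_cast hn
  set q := κ / (1 + √D) ^ 2 with hq
  have hq0 : 0 < q := by positivity
  have hwi : ∀ i, HasGaussianLaw (w i) P := fun i => hw.eval i
  have hvar : ∀ i, Var[w i; P] = 1 := fun i => by
    rw [← covariance_self (hwi i).aemeasurable, hcov]; simp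
  have hL2 : ∀ i, MemLp (fun ω => w i ω ^ 2) 2 P := fun i => memLp_two_sq_of_hasGaussianLaw (hwi i)
  have hind : iIndepFun w P := hw.iIndepFun_of_covariance_eq_zero fun i j hij => by
    rw [hcov, if_neg hij]
  have hEsq : ∀ i, ∫ ω, w i ω ^ 2 ∂P = 1 := fun i => by
    have := variance_of_integral_eq_zero (hwi i).aemeasurable (h0 i)
    rw [hvar] at this
    exact this.symm
  set Z : Fin n → Ω → ℝ := fun i ω => (ν i - 1) * w i ω ^ 2 with hZ
  have hZL2 : ∀ i, MemLp (Z i) 2 P := fun i => (hL2 i).const_mul _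
  have hZind : ∀ i j, i ≠ j → Z i ⟂ᵢ[P] Z j := fun i j hij =>
    (hind.indepFun hij).comp (φ := fun x => (ν i - 1) * x ^ 2) (ψ := fun x => (ν j - 1) * x ^ 2)
      (by fun_prop) (by fun_prop)
  have hsumL2 : MemLp (∑ i, Z i) 2 P := memLp_finsetSum' _ fun i _ => hZL2 i
  have hVar : Var[∑ i, Z i; P] ≤ n * ((D + 1) ^ 2 * sqGaussianVariance) := by
    rw [IndepFun.variance_sum (fun i _ => hZL2 i) (fun i _ j _ hij => hZind i j hij)]
    calc ∑ i, Var[Z i; P] ≤ ∑ _i : Fin n, (D + 1) ^ 2 * sqGaussianVariance := by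
          refine Finset.sum_le_sum fun i _ => ?_
          rw [hZ, variance_const_mul, variance_sq_of_standard (hwi i) (h0 i) (hvar i)]
          refine mul_le_mul_of_nonneg_right ?_ sqGaussianVariance_nonneg
          have := hν i
          have := hD i
          exact sq_le_sq' (by linarith) (by linarith)
      _ = _ := by simp
  have hE : ∫ ω, (∑ i, Z i) ω ∂P = ∑ i, (ν i - 1) := by
    simp only [Finset.sum_apply]
    rw [integral_finsetSum _ fun i _ => (hZL2 i).integrable (by norm_num)]
    refine Finset.sum_congr rfl fun i _ => ?_
    rw [hZ, integral_const_mul, hEsq, mul_one]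
  -- The expectation of the whole sum is at least `q n`, so falling below `q n / 2` is a deviation
  -- of at least `q n / 2`.
  have hm : q * n ≤ ∑ i, (ν i - 1 - Real.log (ν i)) := by
    calc q * n = κ * n / (1 + √D) ^ 2 := by rw [hq]; ring
      _ ≤ (∑ i, (ν i - 1) ^ 2) / (1 + √D) ^ 2 := by gcongr
      _ = ∑ i, (ν i - 1) ^ 2 / (1 + √D) ^ 2 := by rw [Finset.sum_div]
      _ ≤ _ := Finset.sum_le_sum fun i _ => sq_one_sub_le_sub_log (hν i) (hD i)
  calc P {ω | ∑ i, (-Real.log (ν i) + (ν i - 1) * w i ω ^ 2) ≤ q / 2 * n}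
      ≤ P {ω | q * n / 2 ≤ |(∑ i, Z i) ω - P[∑ i, Z i]|} := by
        refine measure_mono fun ω hω => ?_
        simp only [Set.mem_ofPred_eq, Finset.sum_add_distrib, Finset.sum_neg_distrib] at hω ⊢
        rw [hE, Finset.sum_apply, abs_sub_comm]
        rw [Finset.sum_sub_distrib] at hm
        refine le_trans ?_ (le_abs_self _)
        linarith
    _ ≤ ENNReal.ofReal (Var[∑ i, Z i; P] / (q * n / 2) ^ 2) :=
        meas_ge_le_variance_div_sq hsumL2 (by positivity)
    _ ≤ _ := by
        refine ENNReal.ofReal_le_ofReal ?_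
        calc _ ≤ n * ((D + 1) ^ 2 * sqGaussianVariance) / (q * n / 2) ^ 2 := by gcongr
          _ = _ := by field_simp; ring

lemma mulVec_hasGaussianLaw {y : Fin n → Ω → ℝ} (hy : HasGaussianLaw (fun ω i => y i ω) P)
    (B : Matrix (Fin n) (Fin n) ℝ) :
    HasGaussianLaw (fun ω i => (B *ᵥ fun j => y j ω) i) P := by
  have := hy.map_fun (LinearMap.toContinuousLinearMap (Matrix.toLin' B))
  simpa using this

lemma covariance_mulVec [IsFiniteMeasure P] {y : Fin n → Ω → ℝ} (hy : ∀ i, MemLp (y i) 2 P)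
    {R₀ : Matrix (Fin n) (Fin n) ℝ} (hcov : ∀ i j, cov[y i, y j; P] = R₀ i j)
    (B : Matrix (Fin n) (Fin n) ℝ) (i j : Fin n) :
    cov[fun ω => (B *ᵥ fun k => y k ω) i, fun ω => (B *ᵥ fun k => y k ω) j; P] =
      (B * R₀ * Bᵀ) i j := by
  simp only [mulVec, dotProduct]
  rw [covariance_fun_sum_fun_sum (fun k => (hy k).const_mul _) (fun k => (hy k).const_mul _)]
  simp only [covariance_const_mul_left, covariance_const_mul_right, hcov, Matrix.mul_apply,
    Matrix.transpose_apply, Finset.sum_mul]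
  rw [Finset.sum_comm]
  exact Finset.sum_congr rfl fun k _ => Finset.sum_congr rfl fun l _ => by ring

/-- If `R` is far from the true covariance matrix `R₀` in Frobenius norm, then the likelihood
criterion at `R` exceeds the one at `R₀` by a fixed amount with high probability. -/
lemma exists_measure_negLogLik_le [IsProbabilityMeasure P] {c C κ : ℝ} (hc : 0 < c) (hC : 0 < C) (hκ : 0 < κ) :
    ∃ δ > 0, ∃ V : ℝ, ∀ (n : ℕ), 0 < n → ∀ (y : Fin n → Ω → ℝ) (R₀ R : Matrix (Fin n) (Fin n) ℝ),
      HasGaussianLaw (fun ω i => y i ω) P → (∀ i, P[y i] = 0) →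
      (∀ i j, cov[y i, y j; P] = R₀ i j) → R₀ᵀ = R₀ → Rᵀ = R →
      (∀ x, c * (x ⬝ᵥ x) ≤ x ⬝ᵥ R₀ *ᵥ x) → (∀ x, c * (x ⬝ᵥ x) ≤ x ⬝ᵥ R *ᵥ x) →
      (∀ x, x ⬝ᵥ R₀ *ᵥ x ≤ C * (x ⬝ᵥ x)) → (∀ x, x ⬝ᵥ R *ᵥ x ≤ C * (x ⬝ᵥ x)) →
      κ * n ≤ ∑ i, ∑ j, (R i j - R₀ i j) ^ 2 →
      P {ω | negLogLik R (fun i => y i ω) - negLogLik R₀ (fun i => y i ω) ≤ δ} ≤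
        ENNReal.ofReal (V / n) := by
  set D := C / c with hD
  have hD0 : 0 < D := by positivity
  -- The factor `C ^ 2` is the cost of undoing the congruence by `A` in Frobenius norm, and `D ^ 2`
  -- that of replacing `μ i - 1` by `(μ i)⁻¹ - 1`. Neither involves `n`.
  set κ' := κ / (C ^ 2 * D ^ 2) with hκ'
  have hκ'0 : 0 < κ' := by positivity
  refine ⟨κ' / (1 + √D) ^ 2 / 2, by positivity,
    4 * (D + 1) ^ 2 * sqGaussianVariance / (κ' / (1 + √D) ^ 2) ^ 2,
    fun n hn y R₀ R hy hy0 hcov hs₀ hs hc₀ hcR hC₀ hCR hfar => ?_⟩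
  have hn' : (0 : ℝ) < n := by exact_mod_cast hn
  obtain ⟨A, B, μ, hμ, hAB, hBA, hR₀, hR⟩ := exists_simultaneous_diagonalization
    (posDef_of_form_lower_bound hs₀ hc hc₀) (posDef_of_form_lower_bound hs hc hcR)
  have hμD : ∀ i, (μ i)⁻¹ ≤ D ∧ μ i ≤ D := by
    intro i
    obtain ⟨x, hx, hx'⟩ := exists_rayleigh_vector hBA hR₀ hR i
    have e1 := hc₀ x
    have e2 := hcR x
    have e3 := hC₀ x
    have e4 := hCR x
    rw [hx] at e1 e3
    rw [hx'] at e2 e4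
    constructor
    · rw [inv_le_iff_one_le_mul₀ (hμ i), hD, div_mul_eq_mul_div, le_div_iff₀ hc]
      calc 1 * c ≤ C * (x ⬝ᵥ x) * c := by gcongr
        _ = C * (c * (x ⬝ᵥ x)) := by ring
        _ ≤ C * μ i := by gcongr
    · rw [hD, le_div_iff₀ hc]
      calc μ i * c ≤ C * (x ⬝ᵥ x) * c := by gcongr
        _ = C * (c * (x ⬝ᵥ x)) := by ring
        _ ≤ C * 1 := by gcongr
        _ = C := mul_one C
  have hS : κ' * n ≤ ∑ i, ((μ i)⁻¹ - 1) ^ 2 := by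
    have h1 : ∑ i, ∑ j, (R i j - R₀ i j) ^ 2 ≤ C ^ 2 * ∑ i, (μ i - 1) ^ 2 := by
      have := sum_sq_congruence_le hC.le (fun x => by rw [← hR₀]; exact hC₀ x)
        (diagonal fun i => μ i - 1)
      have e : A * (diagonal fun i => μ i - 1) * Aᵀ = R - R₀ := by
        rw [hR, hR₀, ← diagonal_sub, diagonal_one, Matrix.mul_sub, Matrix.sub_mul,
          Matrix.mul_one]
      rw [e] at this
      refine this.trans (le_of_eq ?_)
      congr 1
      refine Finset.sum_congr rfl fun i _ => ?_
      rw [Finset.sum_eq_single i]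
      · simp
      · intro j _ hj; simp [diagonal_apply_ne' _ hj]
      · simp
    have h2 : ∑ i, (μ i - 1) ^ 2 ≤ D ^ 2 * ∑ i, ((μ i)⁻¹ - 1) ^ 2 := by
      rw [Finset.mul_sum]
      refine Finset.sum_le_sum fun i _ => ?_
      have h3 : (μ i - 1) ^ 2 = μ i ^ 2 * ((μ i)⁻¹ - 1) ^ 2 := by
        have := (hμ i).ne'
        field_simp
        ring
      rw [h3]
      have h4 := (hμD i).2
      have h5 := (hμ i).le
      gcongr
    rw [hκ', div_mul_eq_mul_div, div_le_iff₀ (by positivity)]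
    calc κ * n ≤ C ^ 2 * ∑ i, (μ i - 1) ^ 2 := hfar.trans h1
      _ ≤ C ^ 2 * (D ^ 2 * ∑ i, ((μ i)⁻¹ - 1) ^ 2) := by gcongr
      _ = _ := by ring
  have hyi : ∀ i, HasGaussianLaw (y i) P := fun i => hy.eval i
  have := measure_sum_sq_le (w := fun i ω => (B *ᵥ fun j => y j ω) i)
    (mulVec_hasGaussianLaw hy B) (fun i => by
      simp only [mulVec, dotProduct]
      rw [integral_finsetSum _ fun k _ => ((hyi k).integrable).const_mul _]
      simp [integral_const_mul, hy0])
    (fun i j => by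
      rw [covariance_mulVec (fun k => (hyi k).memLp_two) hcov, hR₀]
      have : B * (A * Aᵀ) * Bᵀ = 1 := by
        rw [← Matrix.mul_assoc, hBA, Matrix.one_mul, ← transpose_mul, hBA, transpose_one]
      rw [this, one_apply])
    (fun i => inv_pos.2 (hμ i)) (fun i => (hμD i).1) hκ'0 hn hS
  refine le_trans (measure_mono fun ω hω => ?_) this
  simp only [Set.mem_ofPred_eq] at hω ⊢
  rw [negLogLik_sub_eq hμ hAB hR₀ hR, one_div, inv_mul_le_iff₀ hn'] at hω
  simp only [Real.log_inv, neg_neg]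
  linarith

end Gaussian

/-! ### Quadratic forms at separated points -/

section Lattice

open Matrix

variable {d n : ℕ}

/-- `ℤ^d` is a lattice of rank `d < d + 1`. The term at `u = 0` vanishes because `0⁻¹ = 0`. -/
lemma summable_inv_norm_pow_int (d : ℕ) :
    Summable fun u : Fin d → ℤ => (‖u‖⁻¹) ^ (d + 1) := by
  set L := Submodule.span ℤ (Set.range (Pi.basisFun ℝ (Fin d))) with hL
  have hrank : Module.finrank ℤ L = d := by
    rw [ZLattice.rank ℝ L]; simp
  have hs := ZLattice.summable_norm_pow_inv L (d + 1) (by omega)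
  have hmem : ∀ u : Fin d → ℤ, (fun k => (u k : ℝ)) ∈ L := by
    intro u
    rw [hL, Module.Basis.mem_span_iff_repr_mem]
    intro k
    exact ⟨u k, by simp⟩
  set φ : (Fin d → ℤ) → L := fun u => ⟨fun k => (u k : ℝ), hmem u⟩ with hφ
  have hinj : Function.Injective φ := by
    intro u u' h
    funext k
    have := congrFun (congrArg Subtype.val h) k
    simpa [hφ] using this
  refine (hs.comp_injective hinj).congr fun u => ?_
  have : ‖φ u‖ = ‖u‖ := by
    simp [hφ, Pi.norm_def]
    rfl
  rw [Function.comp_apply, this]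

/-- The lattice sum `∑_{u ≠ 0} |u|_∞^{-(d+1)}` over `ℤ^d`. -/
noncomputable def latticeSum (d : ℕ) : ℝ := ∑' u : Fin d → ℤ, (‖u‖⁻¹) ^ (d + 1)

lemma latticeSum_nonneg (d : ℕ) : 0 ≤ latticeSum d := tsum_nonneg fun _ => by positivity

/-- For fixed `i` the differences `w i - w j` are distinct, so the row sum is a partial sum of the
lattice sum, with no contribution from `j = i`. -/
lemma sum_inv_norm_pow_le {w : Fin n → Fin d → ℤ} (hw : Function.Injective w) (i : Fin n) :
    ∑ j, (‖w i - w j‖⁻¹) ^ (d + 1) ≤ latticeSum d := by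
  have hinj : Function.Injective fun j => w i - w j := fun j k h => hw (by simpa using h)
  have := (summable_inv_norm_pow_int d).sum_le_tsum (Finset.univ.map ⟨_, hinj⟩)
    fun _ _ => by positivity
  rwa [Finset.sum_map] at this

/-- The points `z i` are separated at least as much, up to the factor `δ`, as the distinct integer
points `w i`. -/
structure IsSeparated (δ : ℝ) (w : Fin n → Fin d → ℤ) (z : Fin n → EuclideanSpace ℝ (Fin d)) :
    Prop where
  injective : Function.Injective w
  le_norm : ∀ i j, δ * ‖w i - w j‖ ≤ ‖z i - z j‖

/-- Schur's test for quadratic forms. -/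
lemma sum_mul_le_of_row_sum_le {b : Fin n → Fin n → ℝ} (hb : ∀ i j, 0 ≤ b i j)
    (hs : ∀ i j, b i j = b j i) {S : ℝ} (hS : ∀ i, ∑ j, b i j ≤ S) (x : Fin n → ℝ) :
    ∑ i, ∑ j, b i j * (|x i| * |x j|) ≤ S * (x ⬝ᵥ x) := by
  have h1 : ∑ i, ∑ j, b i j * (|x i| * |x j|) ≤
      ∑ i, ∑ j, (b i j * (x i * x i) / 2 + b i j * (x j * x j) / 2) := by
    refine Finset.sum_le_sum fun i _ => Finset.sum_le_sum fun j _ => ?_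
    have h : |x i| * |x j| ≤ x i * x i / 2 + x j * x j / 2 := by
      rw [← abs_mul_abs_self (x i), ← abs_mul_abs_self (x j)]
      nlinarith [sq_nonneg (|x i| - |x j|)]
    calc _ ≤ b i j * (x i * x i / 2 + x j * x j / 2) := mul_le_mul_of_nonneg_left h (hb i j)
      _ = _ := by ring
  refine h1.trans ?_
  have h2 : ∑ i, ∑ j, b i j * (x j * x j) / 2 = ∑ i, ∑ j, b i j * (x i * x i) / 2 := by
    rw [Finset.sum_comm]
    exact Finset.sum_congr rfl fun i _ => Finset.sum_congr rfl fun j _ => by rw [hs]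
  simp only [Finset.sum_add_distrib]
  rw [h2, ← Finset.sum_add_distrib, dotProduct, Finset.mul_sum]
  refine Finset.sum_le_sum fun i _ => ?_
  rw [← Finset.sum_div, ← Finset.sum_mul, add_halves]
  exact mul_le_mul_of_nonneg_right (hS i) (mul_self_nonneg _)

lemma IsSeparated.norm_pos {δ : ℝ} (hδ : 0 < δ) {w : Fin n → Fin d → ℤ}
    {z : Fin n → EuclideanSpace ℝ (Fin d)} (h : IsSeparated δ w z) {i j : Fin n} (hij : i ≠ j) :
    0 < δ * ‖w i - w j‖ :=
  mul_pos hδ (norm_pos_iff.2 (sub_ne_zero.2 fun e => hij (h.injective e)))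

lemma IsSeparated.offDiag_sum_le {δ : ℝ} (hδ : 0 < δ) {w : Fin n → Fin d → ℤ}
    {z : Fin n → EuclideanSpace ℝ (Fin d)} (h : IsSeparated δ w z)
    {k : EuclideanSpace ℝ (Fin d) → ℝ} {a : ℝ} (ha : 0 ≤ a)
    (hk : ∀ t, t ≠ 0 → |k t| ≤ a / ‖t‖ ^ (d + 1)) (x : Fin n → ℝ) :
    ∑ i, ∑ j, (if i = j then 0 else |k (z i - z j)|) * (|x i| * |x j|) ≤
      a * latticeSum d / δ ^ (d + 1) * (x ⬝ᵥ x) := by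
  refine le_trans (Finset.sum_le_sum fun i _ => Finset.sum_le_sum fun j _ =>
    mul_le_mul_of_nonneg_right ?_ (by positivity))
    (sum_mul_le_of_row_sum_le (b := fun i j => a / δ ^ (d + 1) * (‖w i - w j‖⁻¹) ^ (d + 1))
      (fun i j => by positivity) (fun i j => by rw [norm_sub_rev]) (fun i => ?_) x)
  · by_cases hij : i = j
    · rw [if_pos hij]; positivity
    · rw [if_neg hij]
      have h1 := h.norm_pos hδ hij
      have h2 := h.le_norm i j
      calc _ ≤ a / ‖z i - z j‖ ^ (d + 1) := hk _ (norm_pos_iff.1 (h1.trans_le h2))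
        _ ≤ a / (δ * ‖w i - w j‖) ^ (d + 1) := by gcongr
        _ = _ := by rw [mul_pow, inv_pow, div_mul_eq_div_div, div_eq_mul_inv (a / _)]
  · rw [← Finset.mul_sum, mul_div_right_comm]
    exact mul_le_mul_of_nonneg_left (sum_inv_norm_pow_le h.injective i) (by positivity)

lemma dotProduct_of_mulVec (M : Fin n → Fin n → ℝ) (x : Fin n → ℝ) :
    x ⬝ᵥ (Matrix.of M) *ᵥ x = ∑ i, ∑ j, M i j * (x i * x j) := by
  simp only [dotProduct, mulVec, Finset.mul_sum, of_apply]
  exact Finset.sum_congr rfl fun i _ => Finset.sum_congr rfl fun j _ => by ring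

/-- The diagonal is kept apart so that the estimate serves twice: for upper bounds, and for a lower
bound when `k 0` dominates the off-diagonal part. Decay is required only away from `0`. -/
lemma IsSeparated.abs_form_sub_diag_le {δ : ℝ} (hδ : 0 < δ) {w : Fin n → Fin d → ℤ}
    {z : Fin n → EuclideanSpace ℝ (Fin d)} (h : IsSeparated δ w z)
    {k : EuclideanSpace ℝ (Fin d) → ℝ} {a : ℝ} (ha : 0 ≤ a)
    (hk : ∀ t, t ≠ 0 → |k t| ≤ a / ‖t‖ ^ (d + 1)) (x : Fin n → ℝ) :
    |x ⬝ᵥ (Matrix.of fun i j => k (z i - z j)) *ᵥ x - k 0 * (x ⬝ᵥ x)| ≤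
      a * latticeSum d / δ ^ (d + 1) * (x ⬝ᵥ x) := by
  refine le_trans ?_ (h.offDiag_sum_le hδ ha hk x)
  have e : x ⬝ᵥ (Matrix.of fun i j => k (z i - z j)) *ᵥ x - k 0 * (x ⬝ᵥ x) =
      ∑ i, ∑ j, (if i = j then 0 else k (z i - z j)) * (x i * x j) := by
    rw [dotProduct_of_mulVec, dotProduct, Finset.mul_sum, ← Finset.sum_sub_distrib]
    refine Finset.sum_congr rfl fun i _ => ?_
    have : k 0 * (x i * x i) = ∑ j, if i = j then k 0 * (x i * x j) else 0 := by simp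
    rw [this, ← Finset.sum_sub_distrib]
    refine Finset.sum_congr rfl fun j _ => ?_
    by_cases hij : i = j
    · subst hij; simp
    · simp [hij]
  rw [e]
  refine (Finset.abs_sum_le_sum_abs _ _).trans (Finset.sum_le_sum fun i _ =>
    (Finset.abs_sum_le_sum_abs _ _).trans (Finset.sum_le_sum fun j _ => ?_))
  by_cases hij : i = j
  · simp [hij]
  · simp [hij, abs_mul]

lemma IsSeparated.abs_form_le {δ : ℝ} (hδ : 0 < δ) {w : Fin n → Fin d → ℤ}
    {z : Fin n → EuclideanSpace ℝ (Fin d)} (h : IsSeparated δ w z)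
    {k : EuclideanSpace ℝ (Fin d) → ℝ} {a : ℝ} (ha : 0 ≤ a)
    (hk : ∀ t, |k t| ≤ a / (1 + ‖t‖ ^ (d + 1))) (x : Fin n → ℝ) :
    |x ⬝ᵥ (Matrix.of fun i j => k (z i - z j)) *ᵥ x| ≤
      a * (1 + latticeSum d / δ ^ (d + 1)) * (x ⬝ᵥ x) := by
  have h1 := h.abs_form_sub_diag_le hδ ha (k := k) (fun t ht => (hk t).trans (by
    have := norm_pos_iff.2 ht
    gcongr
    linarith)) x
  have h0 : |k 0| ≤ a := by simpa using hk 0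
  have hx := dotProduct_self_nonneg_real x
  have h2 : |k 0 * (x ⬝ᵥ x)| ≤ a * (x ⬝ᵥ x) := by
    rw [abs_mul, abs_of_nonneg hx]; gcongr
  calc _ ≤ |x ⬝ᵥ (Matrix.of fun i j => k (z i - z j)) *ᵥ x - k 0 * (x ⬝ᵥ x)| + |k 0 * (x ⬝ᵥ x)| := by
        have := abs_add_le (x ⬝ᵥ (Matrix.of fun i j => k (z i - z j)) *ᵥ x - k 0 * (x ⬝ᵥ x))
          (k 0 * (x ⬝ᵥ x))
        rwa [sub_add_cancel] at this
    _ ≤ _ := add_le_add h1 h2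
    _ = _ := by ring

/-- The sum is the squared modulus of `∑ x_i e^{i s_i}`. -/
lemma sum_cos_form_nonneg (x s : Fin n → ℝ) :
    0 ≤ ∑ i, ∑ j, Real.cos (s i - s j) * (x i * x j) := by
  have : ∑ i, ∑ j, Real.cos (s i - s j) * (x i * x j) =
      (∑ i, x i * Real.cos (s i)) ^ 2 + (∑ i, x i * Real.sin (s i)) ^ 2 := by
    rw [sq, sq, Finset.sum_mul_sum, Finset.sum_mul_sum, ← Finset.sum_add_distrib]
    refine Finset.sum_congr rfl fun i _ => ?_
    rw [← Finset.sum_add_distrib]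
    refine Finset.sum_congr rfl fun j _ => ?_
    rw [Real.cos_sub]; ring
  rw [this]; positivity

/-- A compactly supported weight whose cosine transform decays. -/
lemma exists_weight_cosine_decay (d : ℕ) :
    ∃ (g : EuclideanSpace ℝ (Fin d) → ℝ) (C : ℝ), 0 ≤ C ∧ Continuous g ∧ Integrable g ∧
      (∀ f, 0 ≤ g f) ∧ (∀ f, g f ≤ 1) ∧ (∀ f, 1 < ‖f‖ → g f = 0) ∧ 0 < ∫ f, g f ∧
      ∀ t, t ≠ 0 → |∫ f, g f * Real.cos (inner ℝ f t)| ≤ C / ‖t‖ ^ (d + 1) := by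
  set b : ContDiffBump (0 : EuclideanSpace ℝ (Fin d)) := ⟨1 / 2, 1, by norm_num, by norm_num⟩
  have hcs : HasCompactSupport (fun f => (b f : ℂ)) :=
    b.hasCompactSupport.comp_left (g := fun r : ℝ => (r : ℂ)) (by simp)
  have hcd : ContDiff ℝ ((⊤ : ℕ∞) : WithTop ℕ∞) (fun f => (b f : ℂ)) :=
    Complex.ofRealCLM.contDiff.comp b.contDiff
  -- A smooth bump is a Schwartz function, so its Fourier transform decays faster than any power.
  set h := hcs.toSchwartzMap hcd with hh
  obtain ⟨C, hC⟩ := (SchwartzMap.fourierTransformCLM ℂ h).decay (d + 1) 0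
  have hint : Integrable b := b.continuous.integrable_of_hasCompactSupport b.hasCompactSupport
  refine ⟨b, C * (2 * Real.pi) ^ (d + 1), ?_, b.continuous, hint, fun _ => b.nonneg,
    fun _ => b.le_one, fun f hf => b.zero_of_le_dist (by simpa using hf.le), b.integral_pos, ?_⟩
  · exact mul_nonneg hC.1.le (by positivity)
  intro t ht
  -- Evaluation at `t / 2π` absorbs the `2π` in the exponent of the library's Fourier kernel.
  have h2 := hC.2 ((2 * Real.pi)⁻¹ • t)
  rw [norm_iteratedFDeriv_zero] at h2
  have e : ∫ f, b f * Real.cos (inner ℝ f t) =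
      (SchwartzMap.fourierTransformCLM ℂ h ((2 * Real.pi)⁻¹ • t)).re := by
    rw [SchwartzMap.fourierTransformCLM_apply, SchwartzMap.fourier_coe, Real.fourier_eq']
    have hi : Integrable fun f : EuclideanSpace ℝ (Fin d) =>
        Complex.exp (↑(-2 * Real.pi * inner ℝ f ((2 * Real.pi)⁻¹ • t)) * Complex.I) • (h f) := by
      refine (hint.ofReal (𝕜 := ℂ)).bdd_mul (c := 1) (Continuous.aestronglyMeasurable (by fun_prop))
        (ae_of_all _ fun f => ?_)
      rw [Complex.norm_exp_ofReal_mul_I]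
    have := integral_re hi
    simp only [RCLike.re_to_complex] at this
    rw [← this]
    refine integral_congr_ae (ae_of_all _ fun f => ?_)
    have hs : -2 * Real.pi * inner ℝ f ((2 * Real.pi)⁻¹ • t) = -(inner ℝ f t : ℝ) := by
      rw [inner_smul_right]
      have := Real.pi_ne_zero
      field_simp
    have hhf : h f = (b f : ℂ) := rfl
    simp only [hs, hhf, smul_eq_mul, Complex.re_mul_ofReal, Complex.exp_ofReal_mul_I_re,
      Real.cos_neg]
    ring
  rw [e, le_div_iff₀ (pow_pos (norm_pos_iff.2 ht) _)]
  rw [norm_smul, norm_inv, Real.norm_of_nonneg Real.two_pi_pos.le, mul_pow, inv_pow] at h2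
  have hp : 0 < (2 * Real.pi) ^ (d + 1) := by positivity
  rw [mul_assoc, inv_mul_le_iff₀ hp] at h2
  calc _ ≤ ‖SchwartzMap.fourierTransformCLM ℂ h ((2 * Real.pi)⁻¹ • t)‖ * ‖t‖ ^ (d + 1) := by
        gcongr
        exact Complex.abs_re_le_norm _
    _ ≤ _ := by linarith

end Lattice

/-! ### Spectral bounds and regularity of the parametric model -/

section Model

open Matrix

variable {d p : ℕ} {a b : ℝ} {K : (Fin p → ℝ) → EuclideanSpace ℝ (Fin d) → ℝ}

lemma isCompact_paramSet : IsCompact (paramSet p a b) := isCompact_Icc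

/-- The real part of the Fourier transform, i.e. the spectral density. -/
noncomputable def spectralDensity (h : EuclideanSpace ℝ (Fin d) → ℝ)
    (f : EuclideanSpace ℝ (Fin d)) : ℝ := (fourierTransform h f).re

lemma RegularModel.integrable_spectralDensity (hK : RegularModel a b K) {θ : Fin p → ℝ}
    (hθ : θ ∈ paramSet p a b) : Integrable (spectralDensity (K θ)) :=
  (hK.integrable_fourier θ hθ).re

lemma RegularModel.integrable_mul_cos (hK : RegularModel a b K) {θ : Fin p → ℝ}
    (hθ : θ ∈ paramSet p a b) (t : EuclideanSpace ℝ (Fin d)) :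
    Integrable fun f => spectralDensity (K θ) f * Real.cos (inner ℝ f t) :=
  (hK.integrable_spectralDensity hθ).mul_bdd (c := 1)
    (Continuous.aestronglyMeasurable (by fun_prop))
    (ae_of_all _ fun _ => by rw [Real.norm_eq_abs]; exact Real.abs_cos_le_one _)

/-- This is the real part of the inversion formula. Only the cosine survives because the transform
is real. -/
lemma RegularModel.eq_integral_cos (hK : RegularModel a b K) {θ : Fin p → ℝ}
    (hθ : θ ∈ paramSet p a b) (t : EuclideanSpace ℝ (Fin d)) :
    K θ t = ∫ f, spectralDensity (K θ) f * Real.cos (inner ℝ f t) := by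
  have hi : Integrable fun f => fourierTransform (K θ) f *
      Complex.exp (Complex.I * (inner ℝ f t : ℝ)) := by
    refine (hK.integrable_fourier θ hθ).mul_bdd (c := 1)
      (Continuous.aestronglyMeasurable (by fun_prop)) (ae_of_all _ fun f => ?_)
    rw [mul_comm, Complex.norm_exp_ofReal_mul_I]
  have h1 := congrArg Complex.re (hK.inversion θ hθ t)
  have h2 := integral_re hi
  simp only [RCLike.re_to_complex] at h2
  rw [Complex.ofReal_re, ← h2] at h1
  rw [h1]
  refine integral_congr_ae (ae_of_all _ fun f => ?_)
  have h3 := (hK.fourier_pos θ hθ f).2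
  simp only [Complex.mul_re, h3, zero_mul, sub_zero, spectralDensity]
  rw [mul_comm Complex.I, Complex.exp_ofReal_mul_I_re]

lemma RegularModel.continuous_kernel (hK : RegularModel a b K) {θ : Fin p → ℝ}
    (hθ : θ ∈ paramSet p a b) : Continuous (K θ) := by
  rw [funext (hK.eq_integral_cos hθ)]
  refine continuous_of_dominated (bound := fun f => |spectralDensity (K θ) f|)
    (fun t => (hK.integrable_mul_cos hθ t).aestronglyMeasurable)
    (fun t => ae_of_all _ fun f => ?_) (hK.integrable_spectralDensity hθ).abs
    (ae_of_all _ fun f => by fun_prop)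
  rw [norm_mul, Real.norm_eq_abs, Real.norm_eq_abs]
  exact mul_le_of_le_one_right (abs_nonneg _) (Real.abs_cos_le_one _)

lemma RegularModel.kernel_neg (hK : RegularModel a b K) {θ : Fin p → ℝ}
    (hθ : θ ∈ paramSet p a b) (t : EuclideanSpace ℝ (Fin d)) : K θ (-t) = K θ t := by
  simp [hK.eq_integral_cos hθ]

/-- The spectral densities are bounded below on balls, uniformly in the parameter. -/
lemma RegularModel.exists_spectralDensity_ge (hK : RegularModel a b K) (r : ℝ) :
    ∃ m > 0, ∀ θ ∈ paramSet p a b, ∀ f, ‖f‖ ≤ r → m ≤ spectralDensity (K θ) f := by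
  have hc : IsCompact (Metric.closedBall (0 : EuclideanSpace ℝ (Fin d)) r ×ˢ paramSet p a b) :=
    (isCompact_closedBall _ _).prod isCompact_paramSet
  have hcont : ContinuousOn (fun q : EuclideanSpace ℝ (Fin d) × (Fin p → ℝ) =>
      spectralDensity (K q.2) q.1) (Metric.closedBall 0 r ×ˢ paramSet p a b) :=
    Complex.continuous_re.comp_continuousOn
      (hK.fourier_continuous.mono (Set.prod_mono (Set.subset_univ _) subset_rfl))
  obtain ⟨m, hm, h⟩ := hc.exists_forall_le' hcont (a := 0) fun q hq => (hK.fourier_pos q.2 hq.2 q.1).1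
  exact ⟨m, hm, fun θ hθ f hf => h (f, θ) ⟨by simpa using hf, hθ⟩⟩

/-- A uniform lower bound on the eigenvalues of the covariance matrices of separated points. -/
lemma RegularModel.exists_form_lower_bound (hK : RegularModel a b K) {δ : ℝ} (hδ : 0 < δ) :
    ∃ c > 0, ∀ θ ∈ paramSet p a b, ∀ (n : ℕ) (w : Fin n → Fin d → ℤ)
      (z : Fin n → EuclideanSpace ℝ (Fin d)), IsSeparated δ w z → ∀ x : Fin n → ℝ,
      c * (x ⬝ᵥ x) ≤ x ⬝ᵥ (Matrix.of fun i j => K θ (z i - z j)) *ᵥ x := by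
  obtain ⟨g, C, hC, hgc, hgi, hg0, hg1, hgs, hgpos, hdecay⟩ := exists_weight_cosine_decay d
  set G : EuclideanSpace ℝ (Fin d) → ℝ := fun t => ∫ f, g f * Real.cos (inner ℝ f t) with hG
  have hG0 : G 0 = ∫ f, g f := by simp [hG]
  set B := C * latticeSum d / δ ^ (d + 1) with hB
  have hB0 : 0 ≤ B := by
    have := latticeSum_nonneg d
    positivity
  -- The cosine transform of `f ↦ g (f / r)` is `r ^ d G(r t)`. Its off-diagonal form, after
  -- removing `r ^ d`, is at most `B / r ^ (d + 1)`, and this `r` makes that at most half of the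
  -- diagonal value `G 0`.
  set r : ℝ := 1 + 2 * B / G 0 with hr
  have hG0pos : 0 < G 0 := hG0 ▸ hgpos
  have hr1 : 1 ≤ r := by
    have : 0 ≤ 2 * B / G 0 := by positivity
    linarith
  have hr0 : 0 < r := by linarith
  obtain ⟨m, hm, hmK⟩ := hK.exists_spectralDensity_ge r
  refine ⟨m * (r ^ d * (G 0 / 2)), by positivity, fun θ hθ n w z hz x => ?_⟩
  set Q : EuclideanSpace ℝ (Fin d) → ℝ := fun f =>
    ∑ i, ∑ j, Real.cos (inner ℝ f (z i - z j)) * (x i * x j) with hQ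
  have hQ0 : ∀ f, 0 ≤ Q f := fun f => by
    simp only [hQ, inner_sub_right]
    exact sum_cos_form_nonneg x fun i => inner ℝ f (z i)
  have hform : ∀ (h : EuclideanSpace ℝ (Fin d) → ℝ) (y : Fin n → EuclideanSpace ℝ (Fin d)),
      (∀ t, Integrable fun f => h f * Real.cos (inner ℝ f t)) →
      Integrable (fun f => h f * ∑ i, ∑ j, Real.cos (inner ℝ f (y i - y j)) * (x i * x j)) ∧
      ∫ f, h f * ∑ i, ∑ j, Real.cos (inner ℝ f (y i - y j)) * (x i * x j) =
        ∑ i, ∑ j, (∫ f, h f * Real.cos (inner ℝ f (y i - y j))) * (x i * x j) := by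
    intro h y hi
    have e : (fun f => h f * ∑ i, ∑ j, Real.cos (inner ℝ f (y i - y j)) * (x i * x j)) =
        fun f => ∑ i, ∑ j, (h f * Real.cos (inner ℝ f (y i - y j))) * (x i * x j) := by
      funext f
      simp only [Finset.mul_sum, mul_assoc]
    have hij : ∀ i j, Integrable fun f =>
        (h f * Real.cos (inner ℝ f (y i - y j))) * (x i * x j) := fun i j => (hi _).mul_const _
    rw [e]
    refine ⟨integrable_finsetSum _ fun i _ => integrable_finsetSum _ fun j _ => hij i j, ?_⟩
    rw [integral_finsetSum _ fun i _ => integrable_finsetSum _ fun j _ => hij i j]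
    refine Finset.sum_congr rfl fun i _ => ?_
    rw [integral_finsetSum _ fun j _ => hij i j]
    exact Finset.sum_congr rfl fun j _ => integral_mul_const _ _
  have hgcos : ∀ t, Integrable fun f => g f * Real.cos (inner ℝ f t) := fun t =>
    hgi.mul_bdd (c := 1) (Continuous.aestronglyMeasurable (by fun_prop))
      (ae_of_all _ fun _ => by rw [Real.norm_eq_abs]; exact Real.abs_cos_le_one _)
  have hscale : ∫ f, g (r⁻¹ • f) * Q f = r ^ d *
      ∑ i, ∑ j, G (r • (z i - z j)) * (x i * x j) := by
    have h1 := (hform g (fun i => r • z i) hgcos).2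
    have h2 := Measure.integral_comp_smul (μ := (volume : Measure (EuclideanSpace ℝ (Fin d))))
      (fun f => g f * ∑ i, ∑ j, Real.cos (inner ℝ f (r • z i - r • z j)) * (x i * x j)) r⁻¹
    rw [h1] at h2
    simp only [finrank_euclideanSpace, Fintype.card_fin, inv_pow, inv_inv, smul_eq_mul,
      abs_of_pos (pow_pos hr0 d), ← smul_sub, inner_smul_left, inner_smul_right,
      RCLike.conj_to_real] at h2
    simp only [hQ, hG, inner_smul_right]
    rw [← h2]
    refine integral_congr_ae (ae_of_all _ fun f => ?_)
    simp only [mul_inv_cancel_left₀ hr0.ne']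
  have hGform : (G 0 / 2) * (x ⬝ᵥ x) ≤ ∑ i, ∑ j, G (r • (z i - z j)) * (x i * x j) := by
    have h1 := (hz.abs_form_sub_diag_le hδ (k := fun t => G (r • t)) (a := C / r ^ (d + 1))
      (by positivity) (fun t ht => by
        have := hdecay (r • t) (smul_ne_zero hr0.ne' ht)
        rwa [norm_smul, Real.norm_of_nonneg hr0.le, mul_pow, div_mul_eq_div_div] at this) x)
    rw [dotProduct_of_mulVec, smul_zero] at h1
    have h2 := (abs_le.1 h1).1
    have h3 : C / r ^ (d + 1) * latticeSum d / δ ^ (d + 1) ≤ G 0 / 2 := by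
      have e : C / r ^ (d + 1) * latticeSum d / δ ^ (d + 1) = B / r ^ (d + 1) := by
        rw [hB]; ring
      rw [e, div_le_iff₀ (by positivity)]
      have h4 : r ≤ r ^ (d + 1) := le_self_pow₀ hr1 (by omega)
      have h5 : G 0 / 2 * r = G 0 / 2 + B := by
        rw [hr]; field_simp
      calc B ≤ G 0 / 2 * r := by linarith
        _ ≤ _ := by gcongr
    have h6 := mul_le_mul_of_nonneg_right h3 (dotProduct_self_nonneg_real x)
    linarith
  have hKform := hform (spectralDensity (K θ)) z (hK.integrable_mul_cos hθ)
  rw [dotProduct_of_mulVec]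
  -- The spectral density is at least `m` on the ball of radius `r`, which contains the support of
  -- `f ↦ g (f / r)`. Hence it dominates `m g (f / r)` everywhere, and `Q ≥ 0` preserves this under
  -- integration.
  calc m * (r ^ d * (G 0 / 2)) * (x ⬝ᵥ x) = m * (r ^ d * ((G 0 / 2) * (x ⬝ᵥ x))) := by ring
    _ ≤ m * (r ^ d * ∑ i, ∑ j, G (r • (z i - z j)) * (x i * x j)) := by gcongr
    _ = ∫ f, m * (g (r⁻¹ • f) * Q f) := by rw [← hscale, integral_const_mul]
    _ ≤ ∫ f, spectralDensity (K θ) f * Q f := by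
        refine integral_mono_of_nonneg (ae_of_all _ fun f => ?_) hKform.1 (ae_of_all _ fun f => ?_)
        · have := hg0 (r⁻¹ • f)
          have := hQ0 f
          positivity
        · simp only [← mul_assoc]
          refine mul_le_mul_of_nonneg_right ?_ (hQ0 f)
          rcases le_or_gt ‖f‖ r with h | h
          · calc m * g (r⁻¹ • f) ≤ m * 1 := by gcongr; exact hg1 _
              _ ≤ _ := by rw [mul_one]; exact hmK θ hθ f h
          · rw [hgs _ ?_, mul_zero]
            · exact (hK.fourier_pos θ hθ f).1.le
            · rwa [norm_smul, norm_inv, Real.norm_of_nonneg hr0.le, lt_inv_mul_iff₀ hr0, mul_one]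
    _ = _ := by
        rw [hKform.2]
        simp only [← hK.eq_integral_cos hθ]

lemma RegularModel.exists_kernel_bound (hK : RegularModel a b K) :
    ∃ C > 0, ∀ θ ∈ paramSet p a b, ∀ t, |K θ t| ≤ C / (1 + ‖t‖ ^ (d + 1)) := by
  obtain ⟨C, hC⟩ := hK.bound [] (by simp)
  refine ⟨max C 1, by positivity, fun θ hθ t => (hC θ hθ t).trans ?_⟩
  gcongr
  exact le_max_left _ _

lemma update_mem_paramSet {θ : Fin p → ℝ} (hθ : θ ∈ paramSet p a b) {i : Fin p} {s : ℝ}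
    (hs : s ∈ Set.Icc a b) : Function.update θ i s ∈ paramSet p a b := by
  constructor <;> intro j <;> by_cases h : j = i
  · subst h; simpa using hs.1
  · simpa [h] using hθ.1 j
  · subst h; simpa using hs.2
  · simpa [h] using hθ.2 j

/-- The kernels are Lipschitz in the parameter, with a decaying Lipschitz constant. -/
lemma RegularModel.exists_kernel_lipschitz (hK : RegularModel a b K) :
    ∃ C > 0, ∀ θ ∈ paramSet p a b, ∀ θ' ∈ paramSet p a b, ∀ t,
      |K θ' t - K θ t| ≤ C * ‖θ' - θ‖ / (1 + ‖t‖ ^ (d + 1)) := by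
  choose C hC using fun i : Fin p => hK.bound [i] (by simp)
  -- Mean value inequality along one coordinate. The coordinates of `θ` are then replaced by those
  -- of `θ'` one at a time, with `piecewise` points of the cube in between.
  have hone : ∀ i, ∀ θ ∈ paramSet p a b, ∀ s ∈ Set.Icc a b, ∀ t,
      |K (Function.update θ i s) t - K θ t| ≤ |C i| / (1 + ‖t‖ ^ (d + 1)) * |s - θ i| := by
    intro i θ hθ s hs t
    have h := Convex.norm_image_sub_le_of_norm_derivWithin_le
      (f := fun s => K (Function.update θ i s) t) (s := Set.Icc a b)
      (C := |C i| / (1 + ‖t‖ ^ (d + 1))) (x := θ i) (y := s) ?_ ?_ (convex_Icc a b)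
      ⟨hθ.1 i, hθ.2 i⟩ hs
    · simpa using h
    · intro u hu
      have := hK.differentiable [] (by simp) i (Function.update θ i u) (update_mem_paramSet hθ hu) t
      simpa [iterParamPartial] using this
    · intro u hu
      have := hC i (Function.update θ i u) (update_mem_paramSet hθ hu) t
      simp only [iterParamPartial, paramPartial, Function.update_idem, Function.update_self] at this
      refine this.trans ?_
      gcongr
      exact le_abs_self _
  have hmem : ∀ F : Finset (Fin p), ∀ θ ∈ paramSet p a b, ∀ θ' ∈ paramSet p a b,
      F.piecewise θ' θ ∈ paramSet p a b := by
    intro F θ hθ θ' hθ'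
    constructor <;> intro j <;> by_cases h : j ∈ F <;>
      simp [h, hθ.1 j, hθ'.1 j, hθ.2 j, hθ'.2 j]
  have hmany : ∀ θ ∈ paramSet p a b, ∀ θ' ∈ paramSet p a b, ∀ t, ∀ F : Finset (Fin p),
      |K (F.piecewise θ' θ) t - K θ t| ≤
        ∑ i ∈ F, |C i| / (1 + ‖t‖ ^ (d + 1)) * |θ' i - θ i| := by
    intro θ hθ θ' hθ' t F
    induction F using Finset.induction_on with
    | empty => simp
    | insert i F hi ih =>
      rw [Finset.sum_insert hi, Finset.piecewise_insert]
      have h1 := hone i _ (hmem F θ hθ θ' hθ') (θ' i) ⟨hθ'.1 i, hθ'.2 i⟩ t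
      rw [Finset.piecewise_eq_of_notMem _ _ _ hi] at h1
      calc _ ≤ |K (Function.update (F.piecewise θ' θ) i (θ' i)) t - K (F.piecewise θ' θ) t| +
            |K (F.piecewise θ' θ) t - K θ t| := abs_sub_le _ _ _
        _ ≤ _ := add_le_add h1 ih
  refine ⟨1 + ∑ i, |C i|, by positivity, fun θ hθ θ' hθ' t => ?_⟩
  have h := hmany θ hθ θ' hθ' t Finset.univ
  rw [Finset.piecewise_univ] at h
  refine h.trans ?_
  calc ∑ i, |C i| / (1 + ‖t‖ ^ (d + 1)) * |θ' i - θ i|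
      ≤ ∑ i, |C i| / (1 + ‖t‖ ^ (d + 1)) * ‖θ' - θ‖ := by
        gcongr with i
        exact norm_le_pi_norm (θ' - θ) i
    _ = (∑ i, |C i|) * ‖θ' - θ‖ / (1 + ‖t‖ ^ (d + 1)) := by
        rw [← Finset.sum_mul, ← Finset.sum_div]; ring
    _ ≤ _ := by gcongr; linarith

end Model

/-! ### Counting pairs of sites and the law of large numbers -/

section Grid

variable {d : ℕ} {v : ℕ → Fin d → ℤ}

lemma coe_piFinset_Icc (N : ℕ) : {u : Fin d → ℤ | ∀ k, 1 ≤ u k ∧ u k ≤ (N : ℤ)} =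
    (Fintype.piFinset fun _ : Fin d => Finset.Icc (1 : ℤ) N : Finset (Fin d → ℤ)) := by
  ext u; simp [Pi.le_def, forall_and]

/-- The first `N ^ d` indices are mapped onto a set of `N ^ d` points, and `d ≥ 1` allows any two
indices to be placed among them. -/
lemma IsGridSequence.injective (hd : 1 ≤ d) (hv : IsGridSequence v) : Function.Injective v := by
  intro i j hij
  set N := max i j + 1 with hN
  have hNd : N ≤ N ^ d := Nat.le_self_pow (by omega) N
  have h := hv N (by omega)
  have hcard : (v '' Set.Iio (N ^ d)).ncard = (Set.Iio (N ^ d)).ncard := by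
    rw [h, coe_piFinset_Icc, Set.ncard_coe_finset, ← Finset.coe_Iio, Set.ncard_coe_finset]
    simp
  have hinj := Set.injOn_of_ncard_image_eq hcard (Set.finite_Iio _)
  exact hinj (by simp only [Set.mem_Iio]; omega) (by simp only [Set.mem_Iio]; omega) hij

/-- Along a grid sequence, a positive proportion of the points have their translate by `-u` among
the points. -/
lemma IsGridSequence.exists_translates (hd : 1 ≤ d) (hv : IsGridSequence v) (u : Fin d → ℤ) :
    ∃ σ : ℕ → ℕ, ∃ n₀ : ℕ, ∀ n ≥ n₀, ∃ I : Finset ℕ,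
      (∀ i ∈ I, i < n ∧ σ i < n ∧ v i - v (σ i) = u) ∧ n ≤ 4 ^ d * I.card := by
  classical
  have hinj := hv.injective hd
  -- Outside the range of `v` the value of `s` is arbitrary. It is used only at points of the cube,
  -- where it is the true index.
  set s : (Fin d → ℤ) → ℕ := Function.invFun v with hs
  have hsv : ∀ i, s (v i) = i := Function.leftInverse_invFun hinj
  set M : ℕ := ∑ k, (u k).natAbs with hM
  have huM : ∀ k, (u k).natAbs ≤ M := fun k =>
    Finset.single_le_sum (f := fun k => (u k).natAbs) (fun _ _ => Nat.zero_le _) (Finset.mem_univ k)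
  refine ⟨fun i => s (v i - u), (4 * M + 1) ^ d, fun n hn => ?_⟩
  -- `N` will be the side of the largest cube exhausted by the first `n` indices: `N ^ d ≤ n < (N +
  -- 1) ^ d`.
  have hex : ∃ N : ℕ, n < (N + 1) ^ d :=
    ⟨n, (Nat.lt_succ_self n).trans_le (Nat.le_self_pow (by omega) _)⟩
  set N := Nat.find hex with hNdef
  have hN1 : n < (N + 1) ^ d := Nat.find_spec hex
  have hNM : 4 * M + 1 ≤ N := by
    by_contra hlt
    have : (N + 1) ^ d ≤ (4 * M + 1) ^ d := Nat.pow_le_pow_left (by omega) d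
    omega
  have hN2 : N ^ d ≤ n := by
    by_contra hlt
    have := Nat.find_min hex (m := N - 1) (by omega)
    rw [Nat.sub_add_cancel (by omega)] at this
    omega
  have hcube : ∀ w : Fin d → ℤ, (∀ k, 1 ≤ w k ∧ w k ≤ (N : ℤ)) → s w < n ∧ v (s w) = w := by
    intro w hw
    have : w ∈ v '' Set.Iio (N ^ d) := by rw [hv N (by omega)]; exact hw
    obtain ⟨i, hi, rfl⟩ := this
    rw [hsv]
    exact ⟨lt_of_lt_of_le hi hN2, rfl⟩
  -- The margin `M` bounds every `|u k|`, so both `w` and `w - u` stay in the cube. The box has `(N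
  -- - 2 M) ^ d` points, and `N ≥ 4 M + 1` gives `N + 1 ≤ 4 (N - 2 M)`.
  set box : Finset (Fin d → ℤ) := Fintype.piFinset fun _ => Finset.Icc (M + 1 : ℤ) (N - M) with hbox
  have hbox1 : ∀ w ∈ box, ∀ k, 1 ≤ w k ∧ w k ≤ (N : ℤ) := by
    intro w hw k
    have := Fintype.mem_piFinset.1 hw k
    rw [Finset.mem_Icc] at this
    omega
  have hbox2 : ∀ w ∈ box, ∀ k, 1 ≤ (w - u) k ∧ (w - u) k ≤ (N : ℤ) := by
    intro w hw k
    have := Fintype.mem_piFinset.1 hw k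
    rw [Finset.mem_Icc] at this
    have := huM k
    simp only [Pi.sub_apply]
    omega
  refine ⟨box.image s, fun i hi => ?_, ?_⟩
  · obtain ⟨w, hw, rfl⟩ := Finset.mem_image.1 hi
    obtain ⟨h1, h2⟩ := hcube w (hbox1 w hw)
    obtain ⟨h3, h4⟩ := hcube (w - u) (hbox2 w hw)
    simp only [h2, h4]
    exact ⟨h1, h3, by abel⟩
  · rw [Finset.card_image_of_injOn]
    · have hcard : box.card = (N - 2 * M) ^ d := by
        rw [hbox, Fintype.card_piFinset_const, Int.card_Icc]
        congr 1
        omega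
      rw [hcard, ← mul_pow]
      exact hN1.le.trans (Nat.pow_le_pow_left (by omega) d)
    · intro w hw w' hw' h
      rw [← (hcube w (hbox1 w hw)).2, ← (hcube w' (hbox1 w' hw')).2, h]

/-- The pairs `(i, σ i)` have distinct first entries, so the left side is a subsum of nonnegative
terms whether or not `σ` is injective. -/
lemma sum_translates_le {n : ℕ} {F : ℕ → ℕ → ℝ} (hF : ∀ i j, 0 ≤ F i j) {I : Finset ℕ} {σ : ℕ → ℕ}
    (hI : ∀ i ∈ I, i < n ∧ σ i < n) :
    ∑ i ∈ I, F i (σ i) ≤ ∑ i : Fin n, ∑ j : Fin n, F i j := by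
  have e : ∑ i : Fin n, ∑ j : Fin n, F i j = ∑ i ∈ Finset.range n, ∑ j ∈ Finset.range n, F i j := by
    rw [← Fin.sum_univ_eq_sum_range (fun i => ∑ j ∈ Finset.range n, F i j)]
    exact Finset.sum_congr rfl fun i _ => Fin.sum_univ_eq_sum_range (fun j => F i j) n
  rw [e]
  calc ∑ i ∈ I, F i (σ i) ≤ ∑ i ∈ I, ∑ j ∈ Finset.range n, F i j :=
        Finset.sum_le_sum fun i hi => Finset.single_le_sum (f := fun j => F i j)
          (fun j _ => hF i j) (Finset.mem_range.2 (hI i hi).2)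
    _ ≤ _ := Finset.sum_le_sum_of_subset_of_nonneg
        (fun i hi => Finset.mem_range.2 (hI i hi).1)
        fun i _ _ => Finset.sum_nonneg fun j _ => hF i j

variable {Ω : Type*} [MeasurableSpace Ω] {P : Measure Ω} [IsProbabilityMeasure P]
  {E : Type*} [MeasurableSpace E]

lemma covariance_le_one {f g : Ω → ℝ} (hf : Measurable f) (hg : Measurable g)
    (hf01 : ∀ ω, f ω ∈ Set.Icc (0 : ℝ) 1) (hg01 : ∀ ω, g ω ∈ Set.Icc (0 : ℝ) 1) :
    cov[f, g; P] ≤ 1 := by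
  have hfL : MemLp f 2 P := MemLp.of_bound hf.aestronglyMeasurable 1 (ae_of_all _ fun ω => by
    rw [Real.norm_of_nonneg (hf01 ω).1]; exact (hf01 ω).2)
  have hgL : MemLp g 2 P := MemLp.of_bound hg.aestronglyMeasurable 1 (ae_of_all _ fun ω => by
    rw [Real.norm_of_nonneg (hg01 ω).1]; exact (hg01 ω).2)
  rw [covariance_eq_sub hfL hgL]
  have h1 : 0 ≤ ∫ ω, f ω ∂P := integral_nonneg fun ω => (hf01 ω).1
  have h2 : 0 ≤ ∫ ω, g ω ∂P := integral_nonneg fun ω => (hg01 ω).1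
  have h3 : ∫ ω, (f * g) ω ∂P ≤ ∫ _ω, (1 : ℝ) ∂P :=
    integral_mono (hfL.integrable_mul hgL) (integrable_const _)
      fun ω => mul_le_one₀ (hf01 ω).2 (hg01 ω).1 (hg01 ω).2
  have h4 := mul_nonneg h1 h2
  simp only [integral_const, probReal_univ, smul_eq_mul, mul_one] at h3
  linarith

/-- A weak law of large numbers for the number of indices `i` with `X i ∈ A` and `X (σ i) ∈ B`. -/
lemma measure_sum_pair_indicator_le {X : ℕ → Ω → E} (hX : ∀ i, Measurable (X i))
    (hind : iIndepFun X P) {L : Measure E} (hlaw : ∀ i, P.map (X i) = L) {A B : Set E}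
    (hA : MeasurableSet A) (hB : MeasurableSet B) {I : Finset ℕ} {σ : ℕ → ℕ}
    (hσ : ∀ i ∈ I, σ i ≠ i) (hσI : Set.InjOn σ I) (hI : I.Nonempty) (hLA : 0 < L.real A)
    (hLB : 0 < L.real B) :
    P {ω | ∑ i ∈ I, A.indicator 1 (X i ω) * B.indicator 1 (X (σ i) ω) ≤
        L.real A * L.real B / 2 * I.card} ≤
      ENNReal.ofReal (12 / (L.real A * L.real B) ^ 2 / I.card) := by
  classical
  set q := L.real A * L.real B with hq
  have hq0 : 0 < q := mul_pos hLA hLB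
  have hc0 : (0 : ℝ) < I.card := by exact_mod_cast hI.card_pos
  set Z : ℕ → Ω → ℝ := fun i ω => A.indicator 1 (X i ω) * B.indicator 1 (X (σ i) ω) with hZ
  have hmA : Measurable (A.indicator (1 : E → ℝ)) := measurable_one.indicator hA
  have hmB : Measurable (B.indicator (1 : E → ℝ)) := measurable_one.indicator hB
  have hi01 : ∀ (S : Set E) (x : E), S.indicator (1 : E → ℝ) x ∈ Set.Icc (0 : ℝ) 1 := by
    intro S x
    by_cases h : x ∈ S <;> simp [h]
  have hZm : ∀ i, Measurable (Z i) := fun i => (hmA.comp (hX i)).mul (hmB.comp (hX (σ i)))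
  have hZ01 : ∀ i ω, Z i ω ∈ Set.Icc (0 : ℝ) 1 := fun i ω =>
    ⟨mul_nonneg (hi01 _ _).1 (hi01 _ _).1,
      mul_le_one₀ (hi01 _ _).2 (hi01 _ _).1 (hi01 _ _).2⟩
  have hZL : ∀ i, MemLp (Z i) 2 P := fun i => MemLp.of_bound (hZm i).aestronglyMeasurable 1
    (ae_of_all _ fun ω => by rw [Real.norm_of_nonneg (hZ01 i ω).1]; exact (hZ01 i ω).2)
  have hZE : ∀ i ∈ I, ∫ ω, Z i ω ∂P = q := by
    intro i hi
    have h1 := (((hind.indepFun (hσ i hi).symm).comp hmA hmB)).integral_mul_eq_mul_integral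
      (hmA.comp (hX i)).aestronglyMeasurable (hmB.comp (hX (σ i))).aestronglyMeasurable
    have h2 : ∀ (S : Set E) (j : ℕ), MeasurableSet S →
        ∫ ω, (S.indicator (1 : E → ℝ) ∘ X j) ω ∂P = L.real S := by
      intro S j hS
      have : ∫ ω, (S.indicator (1 : E → ℝ) ∘ X j) ω ∂P = ∫ x, S.indicator (1 : E → ℝ) x ∂L := by
        rw [← hlaw j, integral_map (hX j).aemeasurable
          (measurable_one.indicator hS).aestronglyMeasurable]
        rfl
      rw [this, integral_indicator_one hS]
    rw [h2 A i hA, h2 B _ hB] at h1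
    exact h1
  -- `Z i` depends only on the perturbations of index `i` and `σ i`. When the two index pairs are
  -- disjoint the variables are independent; injectivity of `σ` excludes `σ i = σ j`.
  have hcov0 : ∀ i ∈ I, ∀ j ∈ I, j ≠ i → j ≠ σ i → σ j ≠ i → cov[Z i, Z j; P] = 0 := by
    intro i hi j hj h1 h2 h3
    have h := hind.indepFun_prodMk_prodMk hX i (σ i) j (σ j) h1.symm h3.symm h2.symm
      (fun e => h1 (hσI hj hi e.symm))
    have h' := h.comp (φ := fun x : E × E => A.indicator (1 : E → ℝ) x.1 * B.indicator 1 x.2)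
      (ψ := fun x : E × E => A.indicator (1 : E → ℝ) x.1 * B.indicator 1 x.2)
      ((hmA.comp measurable_fst).mul (hmB.comp measurable_snd))
      ((hmA.comp measurable_fst).mul (hmB.comp measurable_snd))
    exact h'.covariance_eq_zero (hZL i) (hZL j)
  -- Only `j = i`, `j = σ i` and the possible `j` with `σ j = i` can contribute, so the variance is
  -- linear rather than quadratic in the number of terms.
  have hrow : ∀ i ∈ I, ∑ j ∈ I, cov[Z i, Z j; P] ≤ 3 := by
    intro i hi
    have hle : ∀ j ∈ I, cov[Z i, Z j; P] ≤
        (if j = i then 1 else 0) + (if j = σ i then 1 else 0) + (if σ j = i then 1 else 0) := by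
      intro j hj
      have hone := covariance_le_one (P := P) (hZm i) (hZm j) (hZ01 i) (hZ01 j)
      by_cases h1 : j = i
      · refine hone.trans ?_
        rw [if_pos h1, add_assoc]
        exact le_add_of_nonneg_right (by positivity)
      by_cases h2 : j = σ i
      · refine hone.trans ?_
        rw [if_neg h1, if_pos h2, zero_add]
        exact le_add_of_nonneg_right (by positivity)
      by_cases h3 : σ j = i
      · refine hone.trans ?_
        rw [if_neg h1, if_neg h2, if_pos h3]; norm_num
      · rw [hcov0 i hi j hj h1 h2 h3]; positivity
    refine (Finset.sum_le_sum hle).trans ?_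
    rw [Finset.sum_add_distrib, Finset.sum_add_distrib, Finset.sum_boole, Finset.sum_boole,
      Finset.sum_boole]
    have c1 : (I.filter fun j => j = i).card ≤ 1 :=
      Finset.card_le_one.2 fun x hx y hy => by
        rw [(Finset.mem_filter.1 hx).2, (Finset.mem_filter.1 hy).2]
    have c2 : (I.filter fun j => j = σ i).card ≤ 1 :=
      Finset.card_le_one.2 fun x hx y hy => by
        rw [(Finset.mem_filter.1 hx).2, (Finset.mem_filter.1 hy).2]
    have c3 : (I.filter fun j => σ j = i).card ≤ 1 :=
      Finset.card_le_one.2 fun x hx y hy => by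
        have hx := Finset.mem_filter.1 hx
        have hy := Finset.mem_filter.1 hy
        exact hσI hx.1 hy.1 (hx.2.trans hy.2.symm)
    have : ((I.filter fun j => j = i).card + (I.filter fun j => j = σ i).card +
      (I.filter fun j => σ j = i).card : ℝ) ≤ ((3 : ℕ) : ℝ) := by
      exact_mod_cast (by omega)
    simpa using this
  have hVar : Var[fun ω => ∑ i ∈ I, Z i ω; P] ≤ 3 * I.card := by
    rw [variance_fun_sum' fun i _ => hZL i]
    calc _ ≤ ∑ _i ∈ I, (3 : ℝ) := Finset.sum_le_sum hrow
      _ = _ := by rw [Finset.sum_const, nsmul_eq_mul, mul_comm]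
  have hE : ∫ ω, ∑ i ∈ I, Z i ω ∂P = q * I.card := by
    rw [integral_finsetSum _ fun i _ => (hZL i).integrable (by norm_num),
      Finset.sum_congr rfl hZE, Finset.sum_const, nsmul_eq_mul, mul_comm]
  have hL2 : MemLp (fun ω => ∑ i ∈ I, Z i ω) 2 P := memLp_finsetSum _ fun i _ => hZL i
  calc P {ω | ∑ i ∈ I, Z i ω ≤ q / 2 * I.card}
      ≤ P {ω | q * I.card / 2 ≤ |∑ i ∈ I, Z i ω - P[fun ω => ∑ i ∈ I, Z i ω]|} := by
        refine measure_mono fun ω hω => ?_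
        simp only [Set.mem_ofPred_eq] at hω ⊢
        rw [hE, abs_sub_comm]
        refine le_trans ?_ (le_abs_self _)
        linarith
    _ ≤ ENNReal.ofReal (Var[fun ω => ∑ i ∈ I, Z i ω; P] / (q * I.card / 2) ^ 2) :=
        meas_ge_le_variance_div_sq hL2 (by positivity)
    _ ≤ _ := by
        refine ENNReal.ofReal_le_ofReal ?_
        calc _ ≤ 3 * I.card / (q * I.card / 2) ^ 2 := by gcongr
          _ = _ := by field_simp; norm_num

lemma obsPoint_sub (v : ℕ → Fin d → ℤ) (ε : ℝ) (x : ℕ → EuclideanSpace ℝ (Fin d)) (i j : ℕ) :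
    obsPoint v ε x i - obsPoint v ε x j = latticePoint (v i - v j) + ε • (x i - x j) := by
  ext k
  simp [obsPoint, latticePoint]
  ring

/-- If the stationary function `k` does not vanish at some limit difference of observation points,
then the sum of the squares of the matrix it defines grows linearly, with high probability. -/
lemma exists_tendsto_measure_sum_sq_lt (hd : 1 ≤ d) (hv : IsGridSequence v) (ε : ℝ)
    {L : Measure (EuclideanSpace ℝ (Fin d))}
    {X : ℕ → Ω → EuclideanSpace ℝ (Fin d)} (hX : ∀ i, Measurable (X i))
    (hind : iIndepFun X P) (hlaw : ∀ i, P.map (X i) = L)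
    {k : EuclideanSpace ℝ (Fin d) → ℝ} (hk : Continuous k)
    (hne : k 0 ≠ 0 ∨ ∃ u : Fin d → ℤ, u ≠ 0 ∧ ∃ s₁ ∈ L.support, ∃ s₂ ∈ L.support,
      k (latticePoint u + ε • (s₁ - s₂)) ≠ 0) :
    ∃ κ > 0, Tendsto (fun n : ℕ => P {ω | ∑ i : Fin n, ∑ j : Fin n,
      k (obsPoint v ε (fun l => X l ω) i - obsPoint v ε (fun l => X l ω) j) ^ 2 < κ * n})
      atTop (𝓝 0) := by
  rcases hne with h0 | ⟨u, hu, s₁, hs₁, s₂, hs₂, hne⟩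
  -- The diagonal entries alone give `k 0 ^ 2 * n`, for every configuration.
  · refine ⟨k 0 ^ 2, by positivity, ?_⟩
    have : ∀ n : ℕ, {ω | ∑ i : Fin n, ∑ j : Fin n,
        k (obsPoint v ε (fun l => X l ω) i - obsPoint v ε (fun l => X l ω) j) ^ 2 <
          k 0 ^ 2 * n} = ∅ := by
      intro n
      refine Set.eq_empty_iff_forall_notMem.2 fun ω hω => ?_
      rw [Set.mem_ofPred_eq] at hω
      refine absurd hω (not_lt.2 ?_)
      have := sum_translates_le (n := n) (I := Finset.range n) (σ := id) (F := fun i j =>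
        k (obsPoint v ε (fun l => X l ω) i - obsPoint v ε (fun l => X l ω) j) ^ 2)
        (fun _ _ => sq_nonneg _) (fun i hi => by simpa using hi)
      simpa [mul_comm] using this
    simp [this]
  have hprob : IsProbabilityMeasure L := hlaw 0 ▸ Measure.isProbabilityMeasure_map (hX 0).aemeasurable
  set φ : EuclideanSpace ℝ (Fin d) × EuclideanSpace ℝ (Fin d) → ℝ := fun x =>
    k (latticePoint u + ε • (x.1 - x.2)) ^ 2 with hφ
  have hφc : Continuous φ := by fun_prop
  set η := φ (s₁, s₂) / 2 with hη
  have hη0 : 0 < η := by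
    have : 0 < φ (s₁, s₂) := by simp only [hφ]; positivity
    positivity
  have hev : {x | η < φ x} ∈ 𝓝 (s₁, s₂) :=
    (isOpen_lt continuous_const hφc).mem_nhds (by
      have : 0 < φ (s₁, s₂) := by linarith
      simp only [Set.mem_ofPred_eq, hη]; linarith)
  obtain ⟨A, B, hAo, hsA, hBo, hsB, hAB⟩ := mem_nhds_prod_iff'.1 hev
  have hLA : 0 < L.real A := ENNReal.toReal_pos
    (Measure.mem_support_iff_forall s₁ |>.1 hs₁ A (hAo.mem_nhds hsA)).ne' (measure_ne_top _ _)
  have hLB : 0 < L.real B := ENNReal.toReal_pos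
    (Measure.mem_support_iff_forall s₂ |>.1 hs₂ B (hBo.mem_nhds hsB)).ne' (measure_ne_top _ _)
  set q := L.real A * L.real B with hq
  have hq0 : 0 < q := mul_pos hLA hLB
  obtain ⟨σ, n₀, hσ⟩ := hv.exists_translates hd u
  have h4 : (0 : ℝ) < 4 ^ d := by positivity
  -- Each pair falling in `A × B` contributes at least `η`; with high probability more than a
  -- fraction `q / 2` of the selected pairs do so, and there are at least `n / 4 ^ d` selected
  -- pairs.
  refine ⟨η * (q / 2) / 4 ^ d, by positivity, ?_⟩
  have hlim : Tendsto (fun n : ℕ => ENNReal.ofReal (12 / q ^ 2 * 4 ^ d / n)) atTop (𝓝 0) := by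
    rw [← ENNReal.ofReal_zero]
    exact ENNReal.tendsto_ofReal (tendsto_const_div_atTop_nhds_zero_nat _)
  refine tendsto_of_tendsto_of_tendsto_of_le_of_le' tendsto_const_nhds hlim
    (Eventually.of_forall fun _ => zero_le) ?_
  filter_upwards [eventually_ge_atTop n₀, eventually_ge_atTop 1] with n hn hn1
  obtain ⟨I, hI, hcard⟩ := hσ n hn
  have hIne : I.Nonempty := by
    rw [← Finset.card_pos]
    by_contra h
    have : I.card = 0 := by omega
    rw [this] at hcard
    omega
  have hcard' : (n : ℝ) ≤ 4 ^ d * I.card := by exact_mod_cast hcard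
  have hn' : (0 : ℝ) < n := by exact_mod_cast hn1
  have hmain := measure_sum_pair_indicator_le hX hind hlaw hAo.measurableSet hBo.measurableSet
    (I := I) (σ := σ) (fun i hi e => hu (by rw [← (hI i hi).2.2, e, sub_self]))
    (fun i hi j hj e => hv.injective hd (by
      have h1 := (hI i hi).2.2
      have h2 := (hI j hj).2.2
      rw [← e] at h2
      exact sub_left_injective (h1.trans h2.symm))) hIne hLA hLB
  refine (measure_mono fun ω hω => ?_).trans (hmain.trans (ENNReal.ofReal_le_ofReal ?_))
  · simp only [Set.mem_ofPred_eq] at hω ⊢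
    have h1 := sum_translates_le (n := n) (I := I) (σ := σ) (F := fun i j =>
        k (obsPoint v ε (fun l => X l ω) i - obsPoint v ε (fun l => X l ω) j) ^ 2)
        (fun _ _ => sq_nonneg _) (fun i hi => ⟨(hI i hi).1, (hI i hi).2.1⟩)
    have h2 : η * ∑ i ∈ I, A.indicator 1 (X i ω) * B.indicator 1 (X (σ i) ω) ≤
        ∑ i ∈ I, k (obsPoint v ε (fun l => X l ω) i - obsPoint v ε (fun l => X l ω) (σ i)) ^ 2 := by
      rw [Finset.mul_sum]
      refine Finset.sum_le_sum fun i hi => ?_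
      rw [obsPoint_sub, (hI i hi).2.2]
      by_cases ha : X i ω ∈ A
      · by_cases hb : X (σ i) ω ∈ B
        · have : η < φ (X i ω, X (σ i) ω) := hAB ⟨ha, hb⟩
          simp only [ha, hb, Set.indicator_of_mem, Pi.one_apply, mul_one]
          exact this.le
        · simp only [hb, not_false_eq_true, Set.indicator_of_notMem, mul_zero]; positivity
      · simp only [ha, not_false_eq_true, Set.indicator_of_notMem, zero_mul, mul_zero]; positivity
    have h3 : η * ∑ i ∈ I, A.indicator 1 (X i ω) * B.indicator 1 (X (σ i) ω) ≤
        η * (q / 2 * I.card) := by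
      refine (h2.trans h1).trans (hω.le.trans ?_)
      calc η * (q / 2) / 4 ^ d * n ≤ η * (q / 2) / 4 ^ d * (4 ^ d * I.card) := by gcongr
        _ = _ := by field_simp
    exact le_of_mul_le_mul_left h3 hη0
  · have hc0 : (0 : ℝ) < I.card := by exact_mod_cast hIne.card_pos
    rw [div_le_div_iff₀ hc0 hn']
    calc 12 / q ^ 2 * n ≤ 12 / q ^ 2 * (4 ^ d * I.card) := by gcongr
      _ = _ := by ring

end Grid

/-! ### Uniform bounds, conditioning on the perturbations, and consistency -/

section Consistency

open Matrix

variable {d p : ℕ} {a b : ℝ} {K : (Fin p → ℝ) → EuclideanSpace ℝ (Fin d) → ℝ}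
  {v : ℕ → Fin d → ℤ} {ε : ℝ}

/-- In each coordinate a nonzero integer difference `m` has `|m| ≥ 1`, so the perturbation, at most
`2 ε`, costs at most the fraction `2 ε` of `|m|`. The Euclidean norm dominates every coordinate. -/
lemma isSeparated_obsPoint (hv : Function.Injective v) (hε₀ : 0 ≤ ε) (hε : ε < 1 / 2)
    {x : ℕ → EuclideanSpace ℝ (Fin d)} (hx : ∀ i k, -1 ≤ x i k ∧ x i k ≤ 1) (n : ℕ) :
    IsSeparated (1 - 2 * ε) (fun i : Fin n => v i) (fun i : Fin n => obsPoint v ε x i) := by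
  refine ⟨hv.comp Fin.val_injective, fun i j => ?_⟩
  have hδ : 0 < 1 - 2 * ε := by linarith
  rw [← le_div_iff₀' hδ]
  refine (pi_norm_le_iff_of_nonneg (by positivity)).2 fun k => ?_
  rw [le_div_iff₀' hδ, obsPoint_sub]
  have hk : ‖(latticePoint (v i - v j) + ε • (x i - x j)) k‖ ≤
      ‖latticePoint (v i - v j) + ε • (x i - x j)‖ := PiLp.norm_apply_le _ k
  refine le_trans ?_ hk
  have e : (latticePoint (v i - v j) + ε • (x i - x j)) k =
      (((v i - v j) k : ℤ) : ℝ) + ε * (x i k - x j k) := by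
    simp [latticePoint]
  rw [e, Real.norm_eq_abs, Int.norm_eq_abs]
  set m : ℤ := (v i - v j) k
  by_cases hm : m = 0
  · rw [hm]; simp; positivity
  · have h1 : (1 : ℝ) ≤ |(m : ℝ)| := by exact_mod_cast Int.one_le_abs hm
    have h2 : |ε * (x i k - x j k)| ≤ 2 * ε := by
      rw [abs_mul, abs_of_nonneg hε₀, mul_comm]
      refine mul_le_mul_of_nonneg_right (abs_le.2 ⟨?_, ?_⟩) hε₀ <;>
        linarith [(hx i k).1, (hx i k).2, (hx j k).1, (hx j k).2]
    have h3 : |(m : ℝ)| - |ε * (x i k - x j k)| ≤ |(m : ℝ) + ε * (x i k - x j k)| := by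
      have := abs_sub_abs_le_abs_sub (m : ℝ) (-(ε * (x i k - x j k)))
      rwa [abs_neg, sub_neg_eq_add] at this
    nlinarith

/-- The uniform spectral bounds on the covariance matrices for one configuration of perturbations:
bounds `c` and `C` on the eigenvalues, and a Lipschitz constant `Λ` in the parameter. -/
structure HasUniformBounds (a b : ℝ) (K : (Fin p → ℝ) → EuclideanSpace ℝ (Fin d) → ℝ)
    (v : ℕ → Fin d → ℤ) (ε c C Λ : ℝ) (x : ℕ → EuclideanSpace ℝ (Fin d)) : Prop where
  lower : ∀ n, ∀ θ ∈ paramSet p a b, ∀ y, c * (y ⬝ᵥ y) ≤ y ⬝ᵥ covMatrix (K θ) v ε x n *ᵥ y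
  upper : ∀ n, ∀ θ ∈ paramSet p a b, ∀ y, y ⬝ᵥ covMatrix (K θ) v ε x n *ᵥ y ≤ C * (y ⬝ᵥ y)
  lipschitz : ∀ n, ∀ θ ∈ paramSet p a b, ∀ θ' ∈ paramSet p a b, ∀ y,
    |y ⬝ᵥ covMatrix (K θ) v ε x n *ᵥ y - y ⬝ᵥ covMatrix (K θ') v ε x n *ᵥ y| ≤
      Λ * ‖θ - θ'‖ * (y ⬝ᵥ y)

/-- The constants depend on the perturbations only through the separation `1 - 2 ε`, hence can be
chosen before `x`. -/
lemma RegularModel.exists_hasUniformBounds (hK : RegularModel a b K) (hv : Function.Injective v)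
    (hε₀ : 0 ≤ ε) (hε : ε < 1 / 2) :
    ∃ c > 0, ∃ C > 0, ∃ Λ > 0, ∀ x : ℕ → EuclideanSpace ℝ (Fin d),
      (∀ i k, -1 ≤ x i k ∧ x i k ≤ 1) → HasUniformBounds a b K v ε c C Λ x := by
  have hδ : 0 < 1 - 2 * ε := by linarith
  obtain ⟨c, hc, hlow⟩ := hK.exists_form_lower_bound hδ
  obtain ⟨C, hC, hup⟩ := hK.exists_kernel_bound
  obtain ⟨Λ, hΛ, hlip⟩ := hK.exists_kernel_lipschitz
  have hS := latticeSum_nonneg d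
  set S := 1 + latticeSum d / (1 - 2 * ε) ^ (d + 1)
  have hS0 : 0 < S := by positivity
  refine ⟨c, hc, C * S, by positivity, Λ * S, by positivity, fun x hx => ⟨?_, ?_, ?_⟩⟩
  · exact fun n θ hθ y => hlow θ hθ n _ _ (isSeparated_obsPoint hv hε₀ hε hx n) y
  · exact fun n θ hθ y => (le_abs_self _).trans
      ((isSeparated_obsPoint hv hε₀ hε hx n).abs_form_le hδ hC.le (hup θ hθ) y)
  · intro n θ hθ θ' hθ' y
    have := (isSeparated_obsPoint hv hε₀ hε hx n).abs_form_le hδ (k := fun t => K θ t - K θ' t)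
      (a := Λ * ‖θ - θ'‖) (by positivity) (fun t => hlip θ' hθ' θ hθ t) y
    have e : (Matrix.of fun i j : Fin n => K θ (obsPoint v ε x i - obsPoint v ε x j) -
        K θ' (obsPoint v ε x i - obsPoint v ε x j)) =
        covMatrix (K θ) v ε x n - covMatrix (K θ') v ε x n := by
      ext i j; rfl
    rw [e, sub_mulVec, dotProduct_sub] at this
    refine this.trans (le_of_eq ?_)
    ring

lemma RegularModel.covMatrix_transpose (hK : RegularModel a b K) {θ : Fin p → ℝ}
    (hθ : θ ∈ paramSet p a b) (x : ℕ → EuclideanSpace ℝ (Fin d)) (n : ℕ) :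
    (covMatrix (K θ) v ε x n)ᵀ = covMatrix (K θ) v ε x n := by
  ext i j
  simp only [covMatrix, transpose_apply, of_apply]
  rw [← hK.kernel_neg hθ, neg_sub]

/-- The inverse is the adjugate divided by the determinant. The formula also holds at singular
matrices, where both conventions give zero. -/
lemma measurable_negLogLik (n : ℕ) : Measurable fun q : (Fin n → Fin n → ℝ) × (Fin n → ℝ) =>
    negLogLik (Matrix.of q.1) q.2 := by
  have hof : Continuous fun q : (Fin n → Fin n → ℝ) × (Fin n → ℝ) => Matrix.of q.1 :=
    continuous_fst
  have hdet : Measurable fun q : (Fin n → Fin n → ℝ) × (Fin n → ℝ) => (Matrix.of q.1).det :=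
    hof.matrix_det.measurable
  have hadj : Measurable fun q : (Fin n → Fin n → ℝ) × (Fin n → ℝ) =>
      q.2 ⬝ᵥ (Matrix.of q.1).adjugate *ᵥ q.2 :=
    (continuous_snd.dotProduct (hof.matrix_adjugate.matrix_mulVec continuous_snd)).measurable
  have e : (fun q : (Fin n → Fin n → ℝ) × (Fin n → ℝ) => negLogLik (Matrix.of q.1) q.2) =
      fun q => (1 / (n : ℝ)) * (Real.log (Matrix.of q.1).det +
        ((Matrix.of q.1).det)⁻¹ * (q.2 ⬝ᵥ (Matrix.of q.1).adjugate *ᵥ q.2)) := by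
    funext q
    rw [negLogLik, Matrix.inv_def, Ring.inverse_eq_inv', smul_mulVec, dotProduct_smul, smul_eq_mul]
  rw [e]
  exact (hdet.log.add (hdet.inv.mul hadj)).const_mul _

section Product

variable {α β : Type*} [MeasurableSpace α] [MeasurableSpace β]

/-- By Fubini, sections over the bad set `t` count for at most `1` and the others for at most `c`.
No measurability of `t` is needed, since the integral of its indicator is at most its outer measure.
-/
lemma measure_prod_le_of_sections {μ : Measure α} [IsProbabilityMeasure μ] {ν : Measure β}
    [IsProbabilityMeasure ν] {s : Set (α × β)} (hs : NullMeasurableSet s (μ.prod ν)) (t : Set α)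
    {c : ENNReal} (h : ∀ᵐ x ∂μ, x ∉ t → ν {y | (x, y) ∈ s} ≤ c) : μ.prod ν s ≤ μ t + c := by
  have hm : AEMeasurable (s.indicator (1 : α × β → ENNReal)) (μ.prod ν) :=
    (aemeasurable_const (b := (1 : ENNReal))).indicator₀ hs
  calc μ.prod ν s = ∫⁻ z, s.indicator 1 z ∂μ.prod ν := (lintegral_indicator_one₀ hs).symm
    _ = ∫⁻ x, ∫⁻ y, s.indicator 1 (x, y) ∂ν ∂μ := lintegral_prod _ hm
    _ ≤ ∫⁻ x, (t.indicator 1 x + c) ∂μ := by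
        refine lintegral_mono_ae ?_
        filter_upwards [h] with x hx
        have h1 : ∫⁻ y, s.indicator (1 : α × β → ENNReal) (x, y) ∂ν ≤ ν {y | (x, y) ∈ s} :=
          lintegral_indicator_one_le {y | (x, y) ∈ s}
        by_cases hxt : x ∈ t
        · refine (h1.trans prob_le_one).trans ?_
          simp [hxt]
        · exact (h1.trans (hx hxt)).trans le_add_self
    _ = ∫⁻ x, t.indicator 1 x ∂μ + c := by
        rw [lintegral_add_right _ measurable_const]; simp
    _ ≤ μ t + c := by gcongr; exact lintegral_indicator_one_le t

end Product

variable {ΩX ΩY : Type*} [MeasurableSpace ΩX] [MeasurableSpace ΩY]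
  {X : ℕ → ΩX → EuclideanSpace ℝ (Fin d)} {Y : EuclideanSpace ℝ (Fin d) → ΩY → ℝ}

lemma aemeasurable_negLogLik_obs {P : Measure (ΩX × ΩY)} {k : EuclideanSpace ℝ (Fin d) → ℝ}
    (hk : Continuous k) (hX : ∀ i, Measurable (X i)) {n : ℕ}
    (hobs : AEMeasurable (obs v ε X Y n) P) :
    AEMeasurable (fun ω => negLogLik (covMatrix k v ε (fun j => X j ω.1) n) (obs v ε X Y n ω))
      P := by
  have hl : ∀ l, Measurable fun ω : ΩX × ΩY => obsPoint v ε (fun j => X j ω.1) l := fun l =>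
    (((hX l).comp measurable_fst).const_smul ε).const_add _
  have hM : Measurable fun (ω : ΩX × ΩY) (i j : Fin n) =>
      k (obsPoint v ε (fun j => X j ω.1) i - obsPoint v ε (fun j => X j ω.1) j) :=
    measurable_pi_lambda _ fun i => measurable_pi_lambda _ fun j =>
      hk.measurable.comp ((hl i).sub (hl j))
  have h := (measurable_negLogLik n).comp_aemeasurable (hM.aemeasurable.prodMk hobs)
  simp only [Function.comp_def] at h
  simp only [covMatrix]
  exact h

/-- The points `z i` may coincide, so the law is read off the finite set of their values and pulled
back by a linear map. -/
lemma hasGaussianLaw_family {PY : Measure ΩY} (hY : IsGaussianProcess Y PY) {n : ℕ}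
    (z : Fin n → EuclideanSpace ℝ (Fin d)) :
    HasGaussianLaw (fun ω i => Y (z i) ω) PY := by
  classical
  set I := Finset.univ.image z
  have hz : ∀ i, z i ∈ I := fun i => Finset.mem_image_of_mem z (Finset.mem_univ i)
  exact (hY.hasGaussianLaw I).map_fun
    (ContinuousLinearMap.pi fun i => ContinuousLinearMap.proj (⟨z i, hz i⟩ : I))

lemma ae_forall_mem_cube {PX : Measure ΩX} {L : Measure (EuclideanSpace ℝ (Fin d))} (hL : IsPerturbationLaw L)
    (hX : ∀ i, Measurable (X i)) (hlaw : ∀ i, PX.map (X i) = L) :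
    ∀ᵐ ω ∂PX, ∀ i k, -1 ≤ X i ω k ∧ X i ω k ≤ 1 := by
  refine ae_all_iff.2 fun i => ?_
  have h : ∀ᵐ t ∂L, t ∈ L.support := Measure.support_mem_ae
  rw [← hlaw i] at h
  filter_upwards [ae_of_ae_map (hX i).aemeasurable h] with ω hω
  exact hL.support_subset (hlaw i ▸ hω)

variable {PX : Measure ΩX} [IsProbabilityMeasure PX] {PY : Measure ΩY} [IsProbabilityMeasure PY]
  {θ₀ : Fin p → ℝ}

/-- The mean square of the observations is bounded in probability. -/
lemma measure_mean_sq_gt_le (hY : IsGaussianProcess Y PY) (hYmean : ∀ t, ∫ ω, Y t ω ∂PY = 0)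
    (hYcov : ∀ s t, covariance (Y s) (Y t) PY = K θ₀ (s - t)) {n : ℕ} (hn : 0 < n)
    (hobs : AEMeasurable (obs v ε X Y n) (PX.prod PY)) {M : ℝ} (hM : 0 < M) :
    PX.prod PY {ω | M < (1 / (n : ℝ)) * (obs v ε X Y n ω ⬝ᵥ obs v ε X Y n ω)} ≤
      ENNReal.ofReal (K θ₀ 0 / M) := by
  have hn' : (0 : ℝ) < n := by exact_mod_cast hn
  have hmeas : AEMeasurable
      (fun ω => (1 / (n : ℝ)) * (obs v ε X Y n ω ⬝ᵥ obs v ε X Y n ω)) (PX.prod PY) :=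
    (Continuous.measurable (f := fun y : Fin n → ℝ => (1 / (n : ℝ)) * (y ⬝ᵥ y))
      (continuous_const.mul (continuous_id.dotProduct continuous_id))).comp_aemeasurable hobs
  suffices h : ∀ᵐ ω₁ ∂PX, ω₁ ∉ (∅ : Set ΩX) → PY {ω₂ | (ω₁, ω₂) ∈ {ω : ΩX × ΩY |
      M < (1 / (n : ℝ)) * (obs v ε X Y n ω ⬝ᵥ obs v ε X Y n ω)}} ≤ ENNReal.ofReal (K θ₀ 0 / M) by
    have := measure_prod_le_of_sections
      (nullMeasurableSet_lt (aemeasurable_const (b := M)) hmeas) ∅ h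
    simpa using this
  refine ae_of_all _ fun ω₁ _ => ?_
  set z : Fin n → EuclideanSpace ℝ (Fin d) := fun i => obsPoint v ε (fun j => X j ω₁) i with hz
  have hL2 : ∀ i, MemLp (Y (z i)) 2 PY := fun i => (hY.hasGaussianLaw_eval (z i)).memLp_two
  have hsq : ∀ i, ∫ ω, Y (z i) ω ^ 2 ∂PY = K θ₀ 0 := fun i => by
    have h1 := hYcov (z i) (z i)
    rw [sub_self, covariance_self (hL2 i).aemeasurable,
      variance_of_integral_eq_zero (hL2 i).aemeasurable (hYmean _)] at h1
    exact h1
  have hint : Integrable (fun ω => ∑ i, Y (z i) ω ^ 2) PY :=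
    integrable_finsetSum _ fun i _ => (hL2 i).integrable_sq
  have hE : ∫ ω, ∑ i, Y (z i) ω ^ 2 ∂PY = n * K θ₀ 0 := by
    rw [integral_finsetSum _ fun i _ => (hL2 i).integrable_sq]
    simp [hsq]
  -- Markov's inequality with the perturbations frozen. By stationarity every observation has second
  -- moment `K θ₀ 0`, so the bound is the same for all of them.
  have hmark := mul_meas_ge_le_integral_of_nonneg
    (ae_of_all PY fun ω => Finset.sum_nonneg fun i _ => sq_nonneg (Y (z i) ω)) hint (n * M)
  rw [hE] at hmark
  have hreal : PY.real {ω | n * M ≤ ∑ i, Y (z i) ω ^ 2} ≤ K θ₀ 0 / M := by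
    rw [le_div_iff₀ hM]
    have : (n : ℝ) * (PY.real {ω | n * M ≤ ∑ i, Y (z i) ω ^ 2} * M) ≤ n * K θ₀ 0 := by
      linarith
    exact le_of_mul_le_mul_left this hn'
  refine (measure_mono (t := {ω | n * M ≤ ∑ i, Y (z i) ω ^ 2}) fun ω hω => ?_).trans ?_
  · simp only [Set.mem_ofPred_eq] at hω ⊢
    rw [one_div, lt_inv_mul_iff₀ hn'] at hω
    refine hω.le.trans (le_of_eq ?_)
    simp only [dotProduct, obs, sq, hz]
  · rw [← ENNReal.ofReal_toReal (measure_ne_top PY _)]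
    exact ENNReal.ofReal_le_ofReal hreal

/-- At a fixed parameter which is distinguishable from the true one, the criterion exceeds its
value at the true parameter by a fixed amount, with high probability. -/
lemma RegularModel.exists_tendsto_measure_negLogLik_le (hK : RegularModel a b K) (hd : 1 ≤ d)
    (hθ₀ : θ₀ ∈ paramSet p a b) (hv : IsGridSequence v) {c C Λ : ℝ} (hc : 0 < c) (hC : 0 < C)
    {L : Measure (EuclideanSpace ℝ (Fin d))} (hX : ∀ i, Measurable (X i)) (hind : iIndepFun X PX)
    (hlaw : ∀ i, PX.map (X i) = L)
    (hbd : ∀ᵐ ω ∂PX, HasUniformBounds a b K v ε c C Λ fun i => X i ω)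
    (hY : IsGaussianProcess Y PY) (hYmean : ∀ t, ∫ ω, Y t ω ∂PY = 0)
    (hYcov : ∀ s t, covariance (Y s) (Y t) PY = K θ₀ (s - t))
    (hobs : ∀ n, AEMeasurable (obs v ε X Y n) (PX.prod PY))
    {θ : Fin p → ℝ} (hθ : θ ∈ paramSet p a b)
    (hne : K θ 0 ≠ K θ₀ 0 ∨ ∃ u : Fin d → ℤ, u ≠ 0 ∧ ∃ s₁ ∈ L.support, ∃ s₂ ∈ L.support,
      K θ (latticePoint u + ε • (s₁ - s₂)) ≠ K θ₀ (latticePoint u + ε • (s₁ - s₂))) :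
    ∃ δ > 0, Tendsto (fun n : ℕ => PX.prod PY {ω |
      negLogLik (covMatrix (K θ) v ε (fun j => X j ω.1) n) (obs v ε X Y n ω) -
        negLogLik (covMatrix (K θ₀) v ε (fun j => X j ω.1) n) (obs v ε X Y n ω) ≤ δ})
      atTop (𝓝 0) := by
  have hcont := hK.continuous_kernel hθ
  have hcont₀ := hK.continuous_kernel hθ₀
  obtain ⟨κ, hκ, hlim⟩ := exists_tendsto_measure_sum_sq_lt (P := PX) hd hv ε hX hind hlaw
    (k := fun t => K θ t - K θ₀ t) (hcont.sub hcont₀) (by simpa only [sub_ne_zero] using hne)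
  obtain ⟨δ, hδ, V, hmain⟩ := exists_measure_negLogLik_le (P := PY) hc hC hκ
  refine ⟨δ, hδ, ?_⟩
  have hlim' := hlim.add (f := fun n : ℕ => _) (g := fun n : ℕ => ENNReal.ofReal (V / n)) (b := 0) (by
    rw [← ENNReal.ofReal_zero]
    exact ENNReal.tendsto_ofReal (tendsto_const_div_atTop_nhds_zero_nat _))
  rw [add_zero] at hlim'
  refine tendsto_of_tendsto_of_tendsto_of_le_of_le' tendsto_const_nhds hlim'
    (Eventually.of_forall fun _ => zero_le) ?_
  filter_upwards [eventually_ge_atTop 1] with n hn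
  -- The bad set consists of the perturbations for which the squared Frobenius distance is below `κ
  -- n`. Off it, for almost every perturbation, the conditional probability is at most `V / n` with
  -- the same `V`.
  refine measure_prod_le_of_sections (nullMeasurableSet_le
    ((aemeasurable_negLogLik_obs hcont hX (hobs n)).sub
      (aemeasurable_negLogLik_obs hcont₀ hX (hobs n))) aemeasurable_const) _ ?_
  filter_upwards [hbd] with ω₁ hω₁ hgood
  simp only [not_lt] at hgood
  have h := hmain n hn (fun i => Y (obsPoint v ε (fun j => X j ω₁) i))
    (covMatrix (K θ₀) v ε (fun j => X j ω₁) n) (covMatrix (K θ) v ε (fun j => X j ω₁) n)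
    (hasGaussianLaw_family hY fun i : Fin n => obsPoint v ε (fun j => X j ω₁) i)
    (fun i => hYmean _) (fun i j => hYcov _ _) (hK.covMatrix_transpose hθ₀ _ n)
    (hK.covMatrix_transpose hθ _ n) (hω₁.lower n θ₀ hθ₀) (hω₁.lower n θ hθ) (hω₁.upper n θ₀ hθ₀)
    (hω₁.upper n θ hθ) hgood
  simp only [Pi.sub_apply]
  exact h

/-- Consistency of maximum likelihood when all parameters are distinguishable from the true one
at the possible differences of observation points. -/
theorem RegularModel.tendstoInMeasure_of_distinguishable (hK : RegularModel a b K) (hd : 1 ≤ d)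
    (hθ₀ : θ₀ ∈ paramSet p a b) (hv : IsGridSequence v) (hε₀ : 0 ≤ ε) (hε : ε < 1 / 2)
    {L : Measure (EuclideanSpace ℝ (Fin d))} (hL : IsPerturbationLaw L)
    (hX : ∀ i, Measurable (X i)) (hind : iIndepFun X PX) (hlaw : ∀ i, PX.map (X i) = L)
    (hY : IsGaussianProcess Y PY) (hYmean : ∀ t, ∫ ω, Y t ω ∂PY = 0)
    (hYcov : ∀ s t, covariance (Y s) (Y t) PY = K θ₀ (s - t))
    (hobs : ∀ n, AEMeasurable (obs v ε X Y n) (PX.prod PY))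
    {T : ℕ → ΩX × ΩY → Fin p → ℝ} (hT : IsMLEstimator (PX.prod PY) a b K v ε X Y T)
    (hne : ∀ θ ∈ paramSet p a b, θ ≠ θ₀ → K θ 0 ≠ K θ₀ 0 ∨
      ∃ u : Fin d → ℤ, u ≠ 0 ∧ ∃ s₁ ∈ L.support, ∃ s₂ ∈ L.support,
        K θ (latticePoint u + ε • (s₁ - s₂)) ≠ K θ₀ (latticePoint u + ε • (s₁ - s₂))) :
    TendstoInMeasure (PX.prod PY) T atTop (fun _ => θ₀) := by
  obtain ⟨c, hc, C, hC, Λ, hΛ, hbounds⟩ :=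
    hK.exists_hasUniformBounds (v := v) (hv.injective hd) hε₀ hε
  have hbd : ∀ᵐ ω ∂PX, HasUniformBounds a b K v ε c C Λ fun i => X i ω := by
    filter_upwards [ae_forall_mem_cube hL hX hlaw] with ω hω
    exact hbounds _ hω
  have hbd' : ∀ᵐ ω ∂PX.prod PY, HasUniformBounds a b K v ε c C Λ fun i => X i ω.1 :=
    Measure.quasiMeasurePreserving_fst.ae hbd
  have hfix : ∀ θ ∈ paramSet p a b, θ ≠ θ₀ → ∃ δ > 0, Tendsto (fun n : ℕ => PX.prod PY {ω |
      negLogLik (covMatrix (K θ) v ε (fun j => X j ω.1) n) (obs v ε X Y n ω) -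
        negLogLik (covMatrix (K θ₀) v ε (fun j => X j ω.1) n) (obs v ε X Y n ω) ≤ δ})
      atTop (𝓝 0) := fun θ hθ hθne =>
    hK.exists_tendsto_measure_negLogLik_le hd hθ₀ hv hc hC hX hind hlaw hbd hY hYmean hYcov hobs hθ
      (hne θ hθ hθne)
  rw [tendstoInMeasure_iff_norm]
  intro α hα
  rw [ENNReal.tendsto_nhds_zero]
  intro η hη
  obtain ⟨M, hM, hMη⟩ : ∃ M : ℝ, 0 < M ∧ ENNReal.ofReal (K θ₀ 0 / M) ≤ η / 2 := by
    have h : Tendsto (fun M : ℝ => ENNReal.ofReal (K θ₀ 0 / M)) atTop (𝓝 0) := by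
      rw [← ENNReal.ofReal_zero]
      exact ENNReal.tendsto_ofReal (tendsto_id.const_div_atTop _)
    have h2 := (ENNReal.tendsto_nhds_zero.1 h) (η / 2) (ENNReal.half_pos hη.ne')
    obtain ⟨M, h3, h4⟩ := (h2.and (eventually_gt_atTop 0)).exists
    exact ⟨M, h4, h3⟩
  choose! δ hδ hδlim using hfix
  -- `q` is a Lipschitz constant in `θ` for the criterion on the event that the mean square of the
  -- observations is at most `M`.
  set q := Λ / c + Λ / c ^ 2 * M with hq
  have hq0 : 0 < q := by positivity
  set A := paramSet p a b ∩ {θ | α ≤ ‖θ - θ₀‖} with hA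
  have hAne : ∀ θ ∈ A, θ ≠ θ₀ := by
    rintro θ ⟨-, h⟩ rfl
    rw [Set.mem_ofPred_eq, sub_self, norm_zero] at h
    linarith
  have hAc : IsCompact A := isCompact_paramSet.inter_right
    (isClosed_le continuous_const (continuous_id.sub continuous_const).norm)
  -- On a ball of radius `δ θ / q` the criterion varies from its value at `θ` by at most `δ θ`. If
  -- the estimator lies there, minimality forces the gap between `θ` and `θ₀` to be at most `δ θ`,
  -- an event of vanishing probability.
  obtain ⟨t, htA, hcover⟩ := hAc.elim_nhds_subcover (fun θ => Metric.ball θ (δ θ / q))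
    fun θ hθ => Metric.ball_mem_nhds _ (div_pos (hδ θ hθ.1 (hAne θ hθ)) hq0)
  have hsum : Tendsto (fun n : ℕ => ∑ θ ∈ t, PX.prod PY {ω |
      negLogLik (covMatrix (K θ) v ε (fun j => X j ω.1) n) (obs v ε X Y n ω) -
        negLogLik (covMatrix (K θ₀) v ε (fun j => X j ω.1) n) (obs v ε X Y n ω) ≤ δ θ})
      atTop (𝓝 0) := by
    rw [← Finset.sum_const_zero (s := t)]
    exact tendsto_finsetSum t fun θ hθ => hδlim θ (htA θ hθ).1 (hAne θ (htA θ hθ))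
  filter_upwards [eventually_ge_atTop 1,
    (ENNReal.tendsto_nhds_zero.1 hsum) (η / 2) (ENNReal.half_pos hη.ne')] with n hn hnsum
  have hn' : 0 < n := hn
  calc PX.prod PY {ω | α ≤ ‖T n ω - θ₀‖}
      ≤ PX.prod PY ({ω | M < (1 / (n : ℝ)) * (obs v ε X Y n ω ⬝ᵥ obs v ε X Y n ω)} ∪
          ⋃ θ ∈ t, {ω | negLogLik (covMatrix (K θ) v ε (fun j => X j ω.1) n) (obs v ε X Y n ω) -
            negLogLik (covMatrix (K θ₀) v ε (fun j => X j ω.1) n) (obs v ε X Y n ω) ≤ δ θ}) := by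
        refine measure_mono_ae ?_
        filter_upwards [hT n hn, hbd'] with ω hTω hbω hω
        by_cases hMω : M < (1 / (n : ℝ)) * (obs v ε X Y n ω ⬝ᵥ obs v ε X Y n ω)
        · exact Or.inl hMω
        refine Or.inr ?_
        rw [not_lt] at hMω
        obtain ⟨θ, hθt, hball⟩ := Set.mem_iUnion₂.1 (hcover ⟨hTω.1, hω⟩)
        refine Set.mem_iUnion₂.2 ⟨θ, hθt, ?_⟩
        have hθ := (htA θ hθt).1
        have h1 := negLogLik_sub_le hn' (hK.covMatrix_transpose hTω.1 _ n)
          (hK.covMatrix_transpose hθ _ n) hc (κ := Λ * ‖T n ω - θ‖) (by positivity)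
          (hbω.lower n _ hTω.1) (hbω.lower n θ hθ) (hbω.lipschitz n _ hTω.1 θ hθ) (obs v ε X Y n ω)
        have h2 := hTω.2 θ₀ hθ₀
        have h3 : ‖T n ω - θ‖ * q ≤ δ θ := by
          rw [← le_div_iff₀ hq0, ← dist_eq_norm]
          exact (Metric.mem_ball.1 hball).le
        have h4 : Λ * ‖T n ω - θ‖ / c + Λ * ‖T n ω - θ‖ / c ^ 2 *
            ((1 / (n : ℝ)) * (obs v ε X Y n ω ⬝ᵥ obs v ε X Y n ω)) ≤ ‖T n ω - θ‖ * q := by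
          calc _ ≤ Λ * ‖T n ω - θ‖ / c + Λ * ‖T n ω - θ‖ / c ^ 2 * M := by gcongr
            _ = _ := by rw [hq]; ring
        simp only [Set.mem_ofPred_eq]
        linarith
    _ ≤ η / 2 + η / 2 := by
        refine (measure_union_le _ _).trans (add_le_add ?_ ?_)
        · exact (measure_mean_sq_gt_le hY hYmean hYcov hn' (hobs n) hM).trans hMη
        · exact (measure_biUnion_finset_le _ _).trans hnsum
    _ = η := ENNReal.add_halves η

end Consistency

end PerturbedGrid

/-! ### Reduction of the two identifiability conditions to pointwise distinguishability -/

theorem mainTheorem3 {d p : ℕ} (hd : 1 ≤ d) (a b : ℝ)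
    -- the parametric model and the true parameter, interior to the parameter set `[a, b]^p`
    (K : (Fin p → ℝ) → EuclideanSpace ℝ (Fin d) → ℝ)
    (hK : PerturbedGrid.RegularModel a b K)
    (θ₀ : Fin p → ℝ) (hθ₀ : ∀ i, a < θ₀ i ∧ θ₀ i < b)
    -- the grid, the regularity parameter and the law of the perturbations
    (v : ℕ → Fin d → ℤ) (hv : PerturbedGrid.IsGridSequence v)
    (ε : ℝ) (hε₀ : 0 ≤ ε) (hε : ε < 1 / 2)
    (L : Measure (EuclideanSpace ℝ (Fin d))) (hL : PerturbedGrid.IsPerturbationLaw L)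
    -- the iid perturbations
    {ΩX : Type*} [MeasurableSpace ΩX] (PX : Measure ΩX) [IsProbabilityMeasure PX]
    (X : ℕ → ΩX → EuclideanSpace ℝ (Fin d)) (hXmeas : ∀ i, Measurable (X i))
    (hXindep : iIndepFun X PX) (hXlaw : ∀ i, PX.map (X i) = L)
    -- the centered stationary Gaussian process with covariance function `K θ₀`
    {ΩY : Type*} [MeasurableSpace ΩY] (PY : Measure ΩY) [IsProbabilityMeasure PY]
    (Y : EuclideanSpace ℝ (Fin d) → ΩY → ℝ) (hY : IsGaussianProcess Y PY)
    (hYmean : ∀ t, ∫ ω, Y t ω ∂PY = 0)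
    (hYcov : ∀ s t, covariance (Y s) (Y t) PY = K θ₀ (s - t))
    -- the observations are random variables on the product space
    (hobs : ∀ n, AEMeasurable (PerturbedGrid.obs v ε X Y n) (PX.prod PY))
    -- any maximum likelihood estimator
    (T : ℕ → ΩX × ΩY → Fin p → ℝ)
    (hT : PerturbedGrid.IsMLEstimator (PX.prod PY) a b K v ε X Y T) :
    (ε = 0 →
      (¬ ∃ θ ∈ PerturbedGrid.paramSet p a b, θ ≠ θ₀ ∧
        ∀ u : Fin d → ℤ,
          K θ (PerturbedGrid.latticePoint u) = K θ₀ (PerturbedGrid.latticePoint u)) →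
      TendstoInMeasure (PX.prod PY) T atTop (fun _ => θ₀)) ∧
    (ε ≠ 0 →
      (¬ ∃ θ ∈ PerturbedGrid.paramSet p a b, θ ≠ θ₀ ∧
        (∀ᵐ t ∂(volume.restrict (PerturbedGrid.diffSet L.support ε)), K θ t = K θ₀ t) ∧
        K θ 0 = K θ₀ 0) →
      TendstoInMeasure (PX.prod PY) T atTop (fun _ => θ₀)) := by
  have hθ₀' : θ₀ ∈ PerturbedGrid.paramSet p a b := ⟨fun i => (hθ₀ i).1.le, fun i => (hθ₀ i).2.le⟩
  have hprob := hL.prob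
  have key := fun hne => hK.tendstoInMeasure_of_distinguishable hd hθ₀' hv hε₀ hε hL hXmeas
    hXindep hXlaw hY hYmean hYcov hobs hT hne
  refine ⟨fun hε0 hid => key fun θ hθ hθne => ?_, fun _ hid => key fun θ hθ hθne => ?_⟩
  · by_contra! h
    refine hid ⟨θ, hθ, hθne, fun u => ?_⟩
    by_cases hu : u = 0
    · have h0 : PerturbedGrid.latticePoint (0 : Fin d → ℤ) = 0 := by
        ext k; simp [PerturbedGrid.latticePoint]
      rw [hu, h0, h.1]
    -- Taking `s₁ = s₂` leaves the bare lattice point, so only a nonempty support is needed.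
    · obtain ⟨s, hs⟩ := Measure.nonempty_support (IsProbabilityMeasure.ne_zero L)
      simpa using h.2 u hu s hs s hs
  · by_contra! h
    refine hid ⟨θ, hθ, hθne, ?_, h.1⟩
    -- The two kernels agree at every point of the difference set, which is stronger than almost
    -- everywhere. Closedness provides the measurability needed to unfold the restricted measure.
    have hclosed : IsClosed {t | K θ t = K θ₀ t} :=
      isClosed_eq (hK.continuous_kernel hθ) (hK.continuous_kernel hθ₀')
    rw [ae_restrict_iff hclosed.measurableSet]
    refine ae_of_all _ fun t ht => ?_
    simp only [PerturbedGrid.diffSet, Set.mem_iUnion₂] at ht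
    obtain ⟨u, hu, ht⟩ := ht
    obtain ⟨r, hr, rfl⟩ := Set.mem_vadd_set.1 ht
    obtain ⟨s, hs, rfl⟩ := Set.mem_smul_set.1 hr
    obtain ⟨s₁, hs₁, s₂, hs₂, rfl⟩ := Set.mem_sub.1 hs
    exact h.2 u hu s₁ hs₁ s₂ hs₂
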